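/- Let $m>n\ge 3$ be integers and let $S_m\ge S_{m-1}\ge\dots\ge S_1>0$ be real numbers. A non-degenerate convex polytope in $\mathbb{R}^n$ is a bounded intersection of finitely many closed half-spaces with non-empty interior; a non-degenerate polytope is a connected union of finitely many non-degenerate convex polytopes. The facets of such a polytope $P$ are the closures of the connected components of the set of those boundary points near which $P$ coincides with a closed half-space (for convex $P$ these are the usual $(n-1)$-dimensional faces), and the area of a facet is its $(n-1)$-dimensional volume. Then the following statements are equivalent: (i) There exists a non-degenerate polytope $P\subset\mathbb{R}^n$ with exactly $m$ facets, whose areas are $S_1,S_2,\dots,S_m$. (ii) There exists a non-degenerate convex polytope $P\subset\mathbb{R}^n$ with exactly $m$ facets, whose areas are $S_1,S_2,\dots,S_m$. (iii) $S_m<S_1+S_2+\dots+S_{m-1}$. Moreover, allow also degenerate polytopes: let a compact set $P\subset\mathbb{R}^n$ with compact sets $F_1,\dots,F_m$ (its facets) be a limiting position of non-degenerate polytopes, or of non-degenerate convex polytopes, with $m$ facets; that is, there are such polytopes $P^{(k)}$ with facets $F^{(k)}_1,\dots,F^{(k)}_m$ such that $P^{(k)}\to P$ and $F^{(k)}_i\to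 F_i$ in the Hausdorff distance, and the area of $F^{(k)}_i$ tends to the area of $F_i$, for each $i$. If $F_i$ has area $S_i$ for $i=1,\dots,m$, then (iii$'$) $S_m\le S_1+\dots+S_{m-1}$, with equality if and only if $P$ degenerates into the doubly counted facet $F_m$, i.e., $P=F_m=F_1\cup\dots\cup F_{m-1}$, where the intersections $F_i\cap F_j$, $1\le i<j\le m-1$, have area $0$. -/

import Mathlib

open scoped MeasureTheory Topology

/-- A non-degenerate convex polytope in `ℝⁿ`: a bounded intersection of finitely many closed
half-spaces that has interior points. -/
def IsConvexPolytope {n : ℕ} (P : Set (EuclideanSpace ℝ (Fin n))) : Prop :=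
  (∃ (k : ℕ) (a : Fin k → EuclideanSpace ℝ (Fin n)) (b : Fin k → ℝ),
      P = {x | ∀ j, inner ℝ (a j) x ≤ b j}) ∧
    Bornology.IsBounded P ∧ (interior P).Nonempty

/-- A non-degenerate (not necessarily convex) polytope in `ℝⁿ`: a connected union of finitely many
non-degenerate convex polytopes. -/
def IsPolytope {n : ℕ} (P : Set (EuclideanSpace ℝ (Fin n))) : Prop :=
  (∃ (k : ℕ) (Q : Fin k → Set (EuclideanSpace ℝ (Fin n))),
      (∀ j, IsConvexPolytope (Q j)) ∧ P = ⋃ j, Q j) ∧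
    IsConnected P

/-- The flat boundary points of `P`: the points near which `P` coincides with a closed half-space
that has the point on its boundary hyperplane. -/
def flatPoints {n : ℕ} (P : Set (EuclideanSpace ℝ (Fin n))) : Set (EuclideanSpace ℝ (Fin n)) :=
  {x | ∃ u : EuclideanSpace ℝ (Fin n), u ≠ 0 ∧ ∀ᶠ y in 𝓝 x, (y ∈ P ↔ inner ℝ u (y - x) ≤ 0)}

/-- The facets of `P`: the closures of the connected components of its set of flat boundary points.
For a non-degenerate convex polytope these components are the relative interiors of the
`(n-1)`-dimensional faces, so that the facets are these faces. -/
def facets {n : ℕ} (P : Set (EuclideanSpace ℝ (Fin n))) : Set (Set (EuclideanSpace ℝ (Fin n))) :=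
  {G | ∃ x ∈ flatPoints P, G = closure (connectedComponentIn (flatPoints P) x)}

/-- `F` lists the facets of `P`, each of them exactly once; in particular `P` has `m` facets. -/
def ListsFacets {n m : ℕ} (P : Set (EuclideanSpace ℝ (Fin n)))
    (F : Fin m → Set (EuclideanSpace ℝ (Fin n))) : Prop :=
  Function.Injective F ∧ Set.range F = facets P

/-- The area, that is, the `(n-1)`-dimensional volume, of a set in `ℝⁿ`: the Hausdorff measure,
normalized so that it is the Lebesgue measure on hyperplanes. -/
noncomputable def area {n : ℕ} (G : Set (EuclideanSpace ℝ (Fin n))) : ENNReal :=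
  μHE[n - 1] G

/-- The compact set `P` with the listed compact sets `F i` as its facets is a limiting position of
polytopes of the class `C` with `m` facets: `P` and its facets are limits, in the Hausdorff
distance, of such polytopes and of their respective facets, and the facet areas converge as well.
Constant sequences show that the members of `C` are included, and the other limiting positions are
the degenerate polytopes, where `P` may be flat, and facets may be coplanar or cover each other. -/
def IsLimitingPosition {n m : ℕ} (C : Set (EuclideanSpace ℝ (Fin n)) → Prop)
    (P : Set (EuclideanSpace ℝ (Fin n))) (F : Fin m → Set (EuclideanSpace ℝ (Fin n))) : Prop :=
  IsCompact P ∧ (∀ i, IsCompact (F i)) ∧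
    ∃ (Pk : ℕ → Set (EuclideanSpace ℝ (Fin n)))
      (Fk : ℕ → Fin m → Set (EuclideanSpace ℝ (Fin n))),
      (∀ k, C (Pk k) ∧ ListsFacets (Pk k) (Fk k)) ∧
      Filter.Tendsto (fun k => Metric.hausdorffEDist (Pk k) P) Filter.atTop (𝓝 0) ∧
      ∀ i, Filter.Tendsto (fun k => Metric.hausdorffEDist (Fk k i) (F i)) Filter.atTop (𝓝 0) ∧
        Filter.Tendsto (fun k => area (Fk k i)) Filter.atTop (𝓝 (area (F i)))

/-- `P` degenerates into the doubly counted facet `F l`: as a set `P` is just `F l`, covered once by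
the facet `F l` and a second time by all the other facets, which do not overlap. -/
def IsDoublyCountedFacet {n m : ℕ} (P : Set (EuclideanSpace ℝ (Fin n)))
    (F : Fin m → Set (EuclideanSpace ℝ (Fin n))) (l : Fin m) : Prop :=
  P = F l ∧ F l = (⋃ i, ⋃ (_ : i ≠ l), F i) ∧
    ∀ i j, i ≠ l → j ≠ l → i ≠ j → area (F i ∩ F j) = 0

/-! (i) ⇒ (iii) is a shadow argument. From a point of a facet `F l` with outward unit normal `u l`,
the ray in direction `-u l` has to leave `P` through a facet whose normal makes an obtuse angle with
`u l` (`ListsFacets.exists_ray`). The projections of these facets along `u l` therefore cover `F l`.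
Projection multiplies the area of a facet by `|⟪u i, u l⟫|` (`area_projAlong_image`), whence `S l ≤
∑ max 0 (-⟪u i, u l⟫) * S i` (`ListsFacets.real_le_sum`). If this were as large as the plain sum,
all other normals would equal `-u l`, and nothing would stop a ray orthogonal to `u l`.

(iii) ⇒ (ii) rests on Minkowski's existence theorem (`exists_polyhedron_area_polyFace_eq`): distinct
spanning unit vectors with `∑ S i • u i = 0` are the facet normals of a convex polytope with facet
areas `S i`. It is proved by maximizing volume over offsets `h ≥ 0` with `∑ S i * h i = 1`. The
partial derivatives of the volume are the face areas, so at a maximum they are proportional to `S`,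
and a dilation finishes. The vectors are the edge directions of a closed polygon with edge lengths
`S i` (`exists_unit_vectors`), built in the plane and then lifted one dimension at a time.

For limiting positions the weighted inequality passes to the limit. In the case of equality all
weights tend to `1`, so the other normals approach `-u l`. The approximating polytopes then have
vanishing height over `F l` (`ListsFacets.height_le`), so their limit is both `F l` and the union of
the other facets. Comparing areas shows that the overlaps are null. -/

/-- `P` coincides near `y` with the half-space with outward normal `u` bounded by the hyperplane
through `y`. -/
def IsNormalAt {n : ℕ} (P : Set (EuclideanSpace ℝ (Fin n))) (u y : EuclideanSpace ℝ (Fin n)) :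
    Prop :=
  ∀ᶠ z in 𝓝 y, (z ∈ P ↔ inner ℝ u (z - y) ≤ 0)

/-! ### Half-spaces: avoiding hyperplanes and comparing normals -/

section HalfSpaces

variable {E : Type*} [NormedAddCommGroup E] [InnerProductSpace ℝ E]

lemma dense_setOf_inner_ne {c : E} (hc : c ≠ 0) (β : ℝ) : Dense {p : E | inner ℝ c p ≠ β} := by
  have hs : Function.Surjective (innerSL ℝ c : E →L[ℝ] ℝ) := by
    intro r
    refine ⟨(r / ‖c‖ ^ 2) • c, ?_⟩
    have : ‖c‖ ≠ 0 := norm_ne_zero_iff.mpr hc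
    simp only [innerSL_apply_apply, inner_smul_right, real_inner_self_eq_norm_sq]
    field_simp
  have ho : IsOpenMap (innerSL ℝ c : E →L[ℝ] ℝ) := by
    intro U hU
    rw [isOpen_iff_mem_nhds]
    rintro _ ⟨x, hx, rfl⟩
    have hcont : Filter.Tendsto (fun r : ℝ => x + ((r - inner ℝ c x) / ‖c‖ ^ 2) • c)
        (𝓝 (inner ℝ c x)) (𝓝 x) := by
      have : Continuous (fun r : ℝ => x + ((r - inner ℝ c x) / ‖c‖ ^ 2) • c) := by fun_prop
      simpa using this.tendsto (inner ℝ c x)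
    filter_upwards [hcont (hU.mem_nhds hx)] with r hr
    refine ⟨_, hr, ?_⟩
    have : ‖c‖ ≠ 0 := norm_ne_zero_iff.mpr hc
    simp only [innerSL_apply_apply, inner_add_right, inner_smul_right, real_inner_self_eq_norm_sq]
    field_simp
    ring
  exact (dense_compl_singleton β).preimage ho

lemma isOpen_setOf_inner_ne (c : E) (β : ℝ) : IsOpen {p : E | inner ℝ c p ≠ β} :=
  isOpen_ne_fun (by fun_prop) continuous_const

/-- Testing the inclusion at `-v` gives the sign of the coefficient. Testing it at the component `z`
of `u` orthogonal to `v` gives `‖z‖ ^ 2 ≤ 0`. -/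
lemma exists_nonneg_smul_of_halfSpace_le {u v : E} (hv : v ≠ 0)
    (h : ∀ z, inner ℝ v z ≤ 0 → inner ℝ u z ≤ 0) : ∃ c : ℝ, 0 ≤ c ∧ u = c • v := by
  have hv2 : (0 : ℝ) < ‖v‖ ^ 2 := by positivity
  refine ⟨inner ℝ v u / ‖v‖ ^ 2, ?_, ?_⟩
  · have := h (-v) (by simp)
    rw [inner_neg_right, real_inner_comm] at this
    exact div_nonneg (by linarith) hv2.le
  · set z := u - (inner ℝ v u / ‖v‖ ^ 2) • v with hz
    have h1 : inner ℝ v z = 0 := by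
      rw [hz, inner_sub_right, inner_smul_right, real_inner_self_eq_norm_sq]
      field_simp
      ring
    have h2 := h z h1.le
    have h3 : inner ℝ u z = inner ℝ z z := by
      conv_rhs => rw [hz, inner_sub_left, inner_smul_left]
      rw [← hz, h1]; simp
    rw [h3, real_inner_self_eq_norm_sq] at h2
    have : z = 0 := by
      rw [← norm_eq_zero]; nlinarith [norm_nonneg z]
    exact sub_eq_zero.mp this

lemma halfSpace_le_of_eventually {u v y : E}
    (h : ∀ᶠ z in 𝓝 y, inner ℝ v (z - y) ≤ 0 → inner ℝ u (z - y) ≤ 0) (z : E)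
    (hz : inner ℝ v z ≤ 0) : inner ℝ u z ≤ 0 := by
  have hcont : Filter.Tendsto (fun t : ℝ => y + t • z) (𝓝[>] 0) (𝓝 y) := by
    have : Continuous (fun t : ℝ => y + t • z) := by fun_prop
    simpa using (this.tendsto 0).mono_left nhdsWithin_le_nhds
  obtain ⟨t, ht, ht0⟩ := ((hcont.eventually h).and self_mem_nhdsWithin).exists
  simp only [add_sub_cancel_left, inner_smul_right] at ht
  have ht0' : (0 : ℝ) < t := ht0
  exact nonpos_of_mul_nonpos_right (ht (mul_nonpos_of_nonneg_of_nonpos ht0'.le hz)) ht0'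

end HalfSpaces

local notation "𝔼[" n "]" => EuclideanSpace ℝ (Fin n)

/-! ### Flat points, facet normals and exit points of rays -/

section PolytopeGeometry

variable {n : ℕ}

lemma IsNormalAt.mem {P : Set 𝔼[n]} {u y : 𝔼[n]} (h : IsNormalAt P u y) : y ∈ P := by
  have := h.self_of_nhds
  simpa using this

lemma IsNormalAt.unique {P : Set 𝔼[n]} {u v y : 𝔼[n]} (hu : IsNormalAt P u y) (hv : IsNormalAt P v y)
    (hu1 : ‖u‖ = 1) (hv1 : ‖v‖ = 1) : u = v := by
  have hv0 : v ≠ 0 := by rintro rfl; simp at hv1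
  obtain ⟨c, hc, rfl⟩ := exists_nonneg_smul_of_halfSpace_le (u := u) hv0
    (halfSpace_le_of_eventually (y := y) (by
      filter_upwards [hu, hv] with z h1 h2 h3
      exact h1.1 (h2.2 h3)))
  rw [norm_smul, hv1, mul_one, Real.norm_of_nonneg hc] at hu1
  simp [hu1]

lemma IsNormalAt.smul {P : Set 𝔼[n]} {u y : 𝔼[n]} (hu : IsNormalAt P u y) {c : ℝ} (hc : 0 < c) :
    IsNormalAt P (c • u) y := by
  filter_upwards [hu] with z hz
  rw [hz, inner_smul_left]
  simp only [conj_trivial]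
  constructor
  · exact fun h => mul_nonpos_of_nonneg_of_nonpos hc.le h
  · exact fun h => nonpos_of_mul_nonpos_right h hc

lemma frequently_notMem_of_mem_flatPoints {P : Set 𝔼[n]} {y : 𝔼[n]} (hy : y ∈ flatPoints P) :
    (∃ᶠ z in 𝓝 y, z ∉ P) := by
  obtain ⟨u, hu, h⟩ := hy
  intro hcon
  simp only [not_not] at hcon
  have := halfSpace_le_of_eventually (u := u) (v := 0) (y := y) (by
    filter_upwards [h, hcon] with z h1 h2 _
    exact h1.1 h2) u (by simp)
  rw [real_inner_self_eq_norm_sq] at this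
  have : ‖u‖ = 0 := by nlinarith [norm_nonneg u]
  exact hu (norm_eq_zero.mp this)

lemma exists_unit_normal_of_mem_flatPoints {P : Set 𝔼[n]} {y : 𝔼[n]} (hy : y ∈ flatPoints P) :
    ∃ u, ‖u‖ = 1 ∧ IsNormalAt P u y := by
  obtain ⟨u, hu, h⟩ := hy
  refine ⟨‖u‖⁻¹ • u, by simp [norm_smul, hu], IsNormalAt.smul h (by positivity)⟩

/-- Near a flat point, the flat points form a disc in the supporting hyperplane: on one side of it
lie interior points of `P`, on the other points outside `P`. -/
lemma IsNormalAt.exists_ball {P : Set 𝔼[n]} {u y : 𝔼[n]} (h : IsNormalAt P u y) :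
    ∃ ε > 0, (∀ z ∈ Metric.ball y ε, inner ℝ u (z - y) = 0 → IsNormalAt P u z) ∧
      ∀ z ∈ Metric.ball y ε, z ∈ flatPoints P → inner ℝ u (z - y) = 0 := by
  obtain ⟨ε, hε, hb⟩ := Metric.eventually_nhds_iff_ball.mp h
  refine ⟨ε, hε, ?_, ?_⟩
  · intro z hz hz0
    filter_upwards [Metric.isOpen_ball.mem_nhds hz] with w hw
    rw [hb w hw]
    have : w - y = (w - z) + (z - y) := by abel
    rw [this, inner_add_right, hz0, add_zero]
  · intro z hz hzf
    rcases lt_trichotomy (inner ℝ u (z - y)) 0 with h1 | h1 | h1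
    · exfalso
      refine frequently_notMem_of_mem_flatPoints hzf ?_
      have hc : ContinuousAt (fun w : 𝔼[n] => inner ℝ u (w - y)) z := by fun_prop
      filter_upwards [Metric.isOpen_ball.mem_nhds hz, hc.eventually_lt continuousAt_const h1]
        with w hw hw2
      simpa using (hb w hw).2 hw2.le
    · exact h1
    · exfalso
      obtain ⟨u', -, h'⟩ := hzf
      have := (hb z hz).1 (IsNormalAt.mem (u := u') h')
      linarith

lemma flatPoints_inter_subset_connectedComponentIn {P : Set 𝔼[n]} {y : 𝔼[n]} (hy : y ∈ flatPoints P) :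
    ∀ᶠ z in 𝓝 y, z ∈ flatPoints P → z ∈ connectedComponentIn (flatPoints P) y := by
  obtain ⟨u, hu, h⟩ := hy
  obtain ⟨ε, hε, h1, h2⟩ := IsNormalAt.exists_ball h
  filter_upwards [Metric.ball_mem_nhds y hε] with z hz hzf
  set T : Set 𝔼[n] := Metric.ball y ε ∩ {z | inner ℝ u (z - y) = 0} with hT
  have hconv : Convex ℝ T := by
    refine (convex_ball y ε).inter ?_
    have : {z : 𝔼[n] | inner ℝ u (z - y) = 0} = {z | innerSL ℝ u z = inner ℝ u y} := by
      ext z; simp [inner_sub_right, sub_eq_zero]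
    rw [this]
    exact convex_hyperplane (f := (innerSL ℝ u : 𝔼[n] →L[ℝ] ℝ)) (by
      exact (innerSL ℝ u : 𝔼[n] →L[ℝ] ℝ).toLinearMap.isLinear) _
  have hsub : T ⊆ flatPoints P := fun w hw => ⟨u, hu, h1 w hw.1 hw.2⟩
  have hyT : y ∈ T := ⟨Metric.mem_ball_self hε, by simp⟩
  exact hconv.isPreconnected.subset_connectedComponentIn hyT hsub ⟨hz, h2 z hz hzf⟩

/-- The unit normal is unique and locally constant along the flat points, hence constant on a
connected component, which therefore stays in one hyperplane. -/
lemma IsNormalAt.of_mem_connectedComponentIn {P : Set 𝔼[n]} {x y z u : 𝔼[n]}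
    (hy : y ∈ connectedComponentIn (flatPoints P) x)
    (hz : z ∈ connectedComponentIn (flatPoints P) x)
    (hu1 : ‖u‖ = 1) (hu : IsNormalAt P u y) : IsNormalAt P u z ∧ inner ℝ u (z - y) = 0 := by
  set C := connectedComponentIn (flatPoints P) x
  have hC : C ⊆ flatPoints P := connectedComponentIn_subset _ _
  -- Quantifying over all unit normals `u` at the first point makes the relation transitive, as the
  -- induction over a preconnected set requires.
  let R : 𝔼[n] → 𝔼[n] → Prop := fun y z => ∀ u, ‖u‖ = 1 → IsNormalAt P u y →
    IsNormalAt P u z ∧ inner ℝ u (z - y) = 0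
  have key : R y z := by
    refine IsPreconnected.induction₂' (s := C) isPreconnected_connectedComponentIn R ?_ ?_ hy hz
    · intro w hw
      obtain ⟨u, hu1, hu⟩ := exists_unit_normal_of_mem_flatPoints (hC hw)
      obtain ⟨ε, hε, h1, h2⟩ := hu.exists_ball
      filter_upwards [mem_nhdsWithin_of_mem_nhds (Metric.ball_mem_nhds w hε),
        self_mem_nhdsWithin] with z hz hzC
      have h0 := h2 z hz (hC hzC)
      have hn := h1 z hz h0
      constructor
      · intro u' hu1' hu'
        obtain rfl := hu'.unique hu hu1' hu1
        exact ⟨hn, h0⟩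
      · intro u' hu1' hu'
        obtain rfl := hu'.unique hn hu1' hu1
        exact ⟨hu, by rw [← neg_sub, inner_neg_right, h0, neg_zero]⟩
    · intro a b c _ _ _ hab hbc u hu1 hu
      obtain ⟨h1, h2⟩ := hab u hu1 hu
      obtain ⟨h3, h4⟩ := hbc u hu1 h1
      refine ⟨h3, ?_⟩
      have : c - a = (c - b) + (b - a) := by abel
      rw [this, inner_add_right, h2, h4, add_zero]
  exact key u hu1 hu

/-- A facet is only known as a closure, so the normal must serve every component with that closure.
There is just one: a flat point in the closure of a component belongs to it, because flat points are
locally connected. -/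
lemma exists_facet_normal {P G : Set 𝔼[n]} (hG : G ∈ facets P) :
    ∃ (u : 𝔼[n]) (b : ℝ), ‖u‖ = 1 ∧ (∀ z ∈ G, inner ℝ u z = b) ∧
      ∀ y ∈ flatPoints P, G = closure (connectedComponentIn (flatPoints P) y) →
        IsNormalAt P u y := by
  obtain ⟨x, hx, rfl⟩ := hG
  obtain ⟨u, hu1, hu⟩ := exists_unit_normal_of_mem_flatPoints hx
  have hxx := mem_connectedComponentIn hx
  refine ⟨u, inner ℝ u x, hu1, ?_, ?_⟩
  · intro z hz
    have hcl : IsClosed {z : 𝔼[n] | inner ℝ u z = inner ℝ u x} :=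
      isClosed_eq (by fun_prop) continuous_const
    refine closure_minimal (fun w hw => ?_) hcl hz
    have := (IsNormalAt.of_mem_connectedComponentIn hxx hw hu1 hu).2
    rwa [inner_sub_right, sub_eq_zero] at this
  · intro y hy hcl
    have hyc : y ∈ closure (connectedComponentIn (flatPoints P) x) := by
      rw [hcl]; exact subset_closure (mem_connectedComponentIn hy)
    obtain ⟨z, hz, hzx⟩ := ((mem_closure_iff_frequently.mp hyc).and_eventually
      (flatPoints_inter_subset_connectedComponentIn hy)).exists
    have hzy := hzx (connectedComponentIn_subset _ _ hz)
    have e1 := connectedComponentIn_eq hz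
    have e2 := connectedComponentIn_eq hzy
    refine (IsNormalAt.of_mem_connectedComponentIn hxx ?_ hu1 hu).1
    rw [e1, ← e2]
    exact mem_connectedComponentIn hy

/-- At a last exit point every convex piece through `y` has a tight constraint facing `v`. By `hpar`
all nonzero tight constraints are multiples of a single `u`, so each such piece is locally the same
half-space, and so is the union. -/
lemma exists_normal_of_exit {k : ℕ} {K : Fin k → ℕ} (a : ∀ j, Fin (K j) → 𝔼[n])
    (b : ∀ j, Fin (K j) → ℝ) {Q : Fin k → Set 𝔼[n]} (hQ : ∀ j, Q j = {x | ∀ i, inner ℝ (a j i) x ≤ b j i})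
    (hint : ∀ j, (interior (Q j)).Nonempty) {y v : 𝔼[n]} (hy : y ∈ ⋃ j, Q j)
    (hexit : ∀ t : ℝ, 0 < t → y + t • v ∉ ⋃ j, Q j)
    (hpar : ∀ j i j' i', a j i ≠ 0 → a j' i' ≠ 0 → inner ℝ (a j i) y = b j i →
      inner ℝ (a j' i') y = b j' i' →
      inner ℝ (a j i) v ≠ 0 ∧ inner ℝ (a j i) v • a j' i' = inner ℝ (a j' i') v • a j i) :
    ∃ u, 0 < inner ℝ u v ∧ IsNormalAt (⋃ j, Q j) u y := by
  have step1 : ∀ j, y ∈ Q j → ∃ i, inner ℝ (a j i) y = b j i ∧ 0 < inner ℝ (a j i) v := by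
    intro j hj
    by_contra! hcon
    have hj' : ∀ i, inner ℝ (a j i) y ≤ b j i := by rw [hQ] at hj; exact hj
    have : ∀ᶠ t : ℝ in 𝓝[>] 0, ∀ i, inner ℝ (a j i) (y + t • v) ≤ b j i := by
      rw [Filter.eventually_all]
      intro i
      rcases (hj' i).eq_or_lt with h | h
      · filter_upwards [self_mem_nhdsWithin] with t ht
        rw [inner_add_right, inner_smul_right, h]
        have := mul_nonpos_of_nonneg_of_nonpos (le_of_lt ht) (hcon i h)
        linarith
      · have hc : ContinuousAt (fun t : ℝ => inner ℝ (a j i) (y + t • v)) 0 := by fun_prop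
        have := hc.eventually_lt (continuousAt_const (y := b j i)) (by simpa using h)
        exact (this.filter_mono nhdsWithin_le_nhds).mono fun _ h => h.le
    obtain ⟨t, ht, ht0⟩ := (this.and self_mem_nhdsWithin).exists
    exact hexit t ht0 (Set.mem_iUnion.mpr ⟨j, by rw [hQ]; exact ht⟩)
  obtain ⟨j0, hj0⟩ := Set.mem_iUnion.mp hy
  obtain ⟨i0, hi0, hv0⟩ := step1 j0 hj0
  set u := a j0 i0 with hu
  have hu0 : u ≠ 0 := by rintro h; simp [h] at hv0
  refine ⟨u, hv0, ?_⟩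
  have hsm : ∀ j i, a j i ≠ 0 → inner ℝ (a j i) y = b j i →
      a j i = (inner ℝ (a j i) v / inner ℝ u v) • u := by
    intro j i h1 h2
    have := (hpar j0 i0 j i hu0 h1 hi0 h2).2
    rw [div_eq_inv_mul, mul_smul, ← this, smul_smul, inv_mul_cancel₀ hv0.ne', one_smul]
  have hin : ∀ j, y ∈ Q j → ∀ᶠ z in 𝓝 y, (z ∈ Q j ↔ inner ℝ u (z - y) ≤ 0) := by
    intro j hj
    obtain ⟨i1, hi1, hv1⟩ := step1 j hj
    have ha1 : a j i1 ≠ 0 := by rintro h; simp [h] at hv1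
    have hle : ∀ z ∈ Q j, inner ℝ u (z - y) ≤ 0 := by
      intro z hz
      rw [hQ] at hz
      have h1 := hz i1
      rw [← hi1, ← sub_nonpos, ← inner_sub_right, hsm j i1 ha1 hi1, inner_smul_left] at h1
      exact nonpos_of_mul_nonpos_right h1 (by simpa using div_pos hv1 hv0)
    -- A tight constraint facing away from `v` would be a negative multiple of `u`. It would squeeze
    -- `Q j` into a hyperplane, although `Q j` has interior points.
    have htight : ∀ i, inner ℝ (a j i) y = b j i → a j i ≠ 0 → 0 < inner ℝ (a j i) v := by
      intro i hi ha
      by_contra! hcon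
      obtain ⟨w, hw⟩ := hint j
      have hge : ∀ z ∈ Q j, inner ℝ u (z - y) = 0 := by
        intro z hz
        refine le_antisymm (hle z hz) ?_
        rw [hQ] at hz
        have h1 := hz i
        have hneg : inner ℝ (a j i) v / inner ℝ u v < 0 :=
          div_neg_of_neg_of_pos (lt_of_le_of_ne hcon (hpar j i j i ha ha hi hi).1) hv0
        rw [← hi, ← sub_nonpos, ← inner_sub_right, hsm j i ha hi, inner_smul_left,
          conj_trivial] at h1
        by_contra! h2
        nlinarith
      have hcont : Filter.Tendsto (fun t : ℝ => w + t • u) (𝓝[>] 0) (𝓝 w) := by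
        have : Continuous (fun t : ℝ => w + t • u) := by fun_prop
        simpa using (this.tendsto 0).mono_left nhdsWithin_le_nhds
      obtain ⟨t, ht, ht0⟩ := ((hcont.eventually (isOpen_interior.mem_nhds hw)).and
        self_mem_nhdsWithin).exists
      have h1 := hge _ (interior_subset ht)
      have h2 := hge _ (interior_subset hw)
      have ht0' : (0 : ℝ) < t := ht0
      rw [inner_sub_right] at h1 h2
      rw [inner_add_right, inner_smul_right, real_inner_self_eq_norm_sq] at h1
      have : t * ‖u‖ ^ 2 = 0 := by linarith
      have : 0 < t * ‖u‖ ^ 2 := by positivity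
      linarith
    have hj' : ∀ i, inner ℝ (a j i) y ≤ b j i := by rw [hQ] at hj; exact hj
    have hback : ∀ᶠ z in 𝓝 y, inner ℝ u (z - y) ≤ 0 → ∀ i, inner ℝ (a j i) z ≤ b j i := by
      have : ∀ᶠ z in 𝓝 y, ∀ i, inner ℝ u (z - y) ≤ 0 → inner ℝ (a j i) z ≤ b j i := by
        rw [Filter.eventually_all]
        intro i
        rcases (hj' i).eq_or_lt with h | h
        · refine Filter.Eventually.of_forall fun z hz => ?_
          by_cases ha : a j i = 0
          · rw [ha] at h ⊢
            simpa using h.le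
          · rw [← h, ← sub_nonpos, ← inner_sub_right, hsm j i ha h, inner_smul_left]
            exact mul_nonpos_of_nonneg_of_nonpos
              (by simpa using (div_pos (htight i h ha) hv0).le) hz
        · have hc : ContinuousAt (fun z : 𝔼[n] => inner ℝ (a j i) z) y := by fun_prop
          exact (hc.eventually_lt (continuousAt_const (y := b j i)) h).mono fun _ h _ => h.le
      exact this.mono fun z h hz i => h i hz
    filter_upwards [hback] with z hz
    refine ⟨hle z, fun h => ?_⟩
    rw [hQ]
    exact hz h
  have hall : ∀ᶠ z in 𝓝 y, ∀ j, (y ∈ Q j → (z ∈ Q j ↔ inner ℝ u (z - y) ≤ 0)) ∧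
      (y ∉ Q j → z ∉ Q j) := by
    rw [Filter.eventually_all]
    intro j
    by_cases hj : y ∈ Q j
    · filter_upwards [hin j hj] with z hz
      exact ⟨fun _ => hz, fun h => absurd hj h⟩
    · have hcl : IsClosed (Q j) := by
        rw [hQ, Set.ofPred_forall]
        exact isClosed_iInter fun i => isClosed_le (by fun_prop) continuous_const
      filter_upwards [hcl.isOpen_compl.mem_nhds hj] with z hz
      exact ⟨fun h => absurd h hj, fun _ => hz⟩
  filter_upwards [hall] with z hz
  constructor
  · intro h
    obtain ⟨j, hj⟩ := Set.mem_iUnion.mp h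
    by_cases hyj : y ∈ Q j
    · exact ((hz j).1 hyj).1 hj
    · exact absurd hj ((hz j).2 hyj)
  · intro h
    exact Set.mem_iUnion.mpr ⟨j0, ((hz j0).1 hj0).2 h⟩

lemma IsConvexPolytope.isClosed {P : Set 𝔼[n]} (h : IsConvexPolytope P) : IsClosed P := by
  obtain ⟨⟨k, a, b, rfl⟩, -⟩ := h
  rw [Set.ofPred_forall]
  exact isClosed_iInter fun i => isClosed_le (by fun_prop) continuous_const

lemma IsConvexPolytope.convex {P : Set 𝔼[n]} (h : IsConvexPolytope P) : Convex ℝ P := by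
  obtain ⟨⟨k, a, b, rfl⟩, -⟩ := h
  rw [Set.ofPred_forall]
  exact convex_iInter fun i =>
    convex_halfSpace_le (f := (innerSL ℝ (a i) : 𝔼[n] →L[ℝ] ℝ)) (LinearMap.isLinear _) _

lemma IsConvexPolytope.isPolytope {P : Set 𝔼[n]} (h : IsConvexPolytope P) : IsPolytope P :=
  ⟨⟨1, fun _ => P, fun _ => h, (Set.iUnion_const P).symm⟩, h.2.2.mono interior_subset, h.convex.isPreconnected⟩

lemma IsPolytope.isCompact {P : Set 𝔼[n]} (h : IsPolytope P) : IsCompact P := by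
  obtain ⟨⟨k, Q, hQ, rfl⟩, -⟩ := h
  exact isCompact_iUnion fun j => Metric.isCompact_of_isClosed_isBounded (hQ j).isClosed (hQ j).2.1

lemma IsPolytope.subset_closure_interior {P : Set 𝔼[n]} (h : IsPolytope P) :
    P ⊆ closure (interior P) := by
  obtain ⟨⟨k, Q, hQ, rfl⟩, -⟩ := h
  refine Set.iUnion_subset fun j => ?_
  have := (hQ j).convex.closure_interior_eq_closure_of_nonempty_interior (hQ j).2.2
  calc Q j ⊆ closure (Q j) := subset_closure
    _ = closure (interior (Q j)) := this.symm
    _ ⊆ _ := closure_mono (interior_mono (Set.subset_iUnion _ j))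

/-- For a dense set of points `p`, every line through `p` in direction `v` that meets tight
constraints does so transversally, and all constraints tight at one point are parallel. -/
lemma dense_transversal {ι : Type*} [Finite ι] (a : ι → 𝔼[n]) (b : ι → ℝ) (v : 𝔼[n]) :
    Dense {p : 𝔼[n] | ∀ (t : ℝ) (i j : ι), a i ≠ 0 → a j ≠ 0 → inner ℝ (a i) (p + t • v) = b i →
      inner ℝ (a j) (p + t • v) = b j →
      inner ℝ (a i) v ≠ 0 ∧ inner ℝ (a i) v • a j = inner ℝ (a j) v • a i} := by
  -- The first set avoids constraint hyperplanes parallel to `v`. The second comes from eliminating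
  -- `t`: the combination of `a i` and `a j` orthogonal to `v` takes a prescribed value at `p`
  -- whenever both constraints are tight on the line through `p`.
  let D : ι × ι → Set 𝔼[n] := fun ij =>
    {p | a ij.1 ≠ 0 → inner ℝ (a ij.1) v = 0 → inner ℝ (a ij.1) p ≠ b ij.1} ∩
    {p | inner ℝ (a ij.1) v • a ij.2 - inner ℝ (a ij.2) v • a ij.1 ≠ 0 →
      inner ℝ (inner ℝ (a ij.1) v • a ij.2 - inner ℝ (a ij.2) v • a ij.1) p ≠
        inner ℝ (a ij.1) v * b ij.2 - inner ℝ (a ij.2) v * b ij.1}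
  have hD : ∀ ij, IsOpen (D ij) ∧ Dense (D ij) := by
    intro ij
    have h1 : IsOpen {p | a ij.1 ≠ 0 → inner ℝ (a ij.1) v = 0 → inner ℝ (a ij.1) p ≠ b ij.1} ∧
        Dense {p | a ij.1 ≠ 0 → inner ℝ (a ij.1) v = 0 → inner ℝ (a ij.1) p ≠ b ij.1} := by
      by_cases h : a ij.1 ≠ 0
      · by_cases h' : inner ℝ (a ij.1) v = 0
        · simp only [h, h', ne_eq, not_false_eq_true, forall_const]
          exact ⟨isOpen_setOf_inner_ne _ _, dense_setOf_inner_ne h _⟩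
        · simp [h']
      · simp [h]
    have h2 : ∀ (c : 𝔼[n]) (β : ℝ), IsOpen {p | c ≠ 0 → inner ℝ c p ≠ β} ∧
        Dense {p | c ≠ 0 → inner ℝ c p ≠ β} := by
      intro c β
      by_cases h : c ≠ 0
      · simp only [h, ne_eq, not_false_eq_true, forall_const]
        exact ⟨isOpen_setOf_inner_ne _ _, dense_setOf_inner_ne h _⟩
      · simp [h]
    exact ⟨h1.1.inter (h2 _ _).1, h1.2.inter_of_isOpen_left (h2 _ _).2 h1.1⟩
  refine (dense_iInter_of_isOpen (fun ij => (hD ij).1) (fun ij => (hD ij).2)).mono ?_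
  intro p hp t i j hi hj hti htj
  rw [Set.mem_iInter] at hp
  have h1 : inner ℝ (a i) v ≠ 0 := by
    intro h0
    refine (hp (i, j)).1 hi h0 ?_
    rw [inner_add_right, inner_smul_right, h0] at hti
    simpa using hti
  refine ⟨h1, ?_⟩
  by_contra hne
  refine (hp (i, j)).2 (sub_ne_zero.mpr hne) ?_
  rw [inner_add_right, inner_smul_right] at hti htj
  simp only [inner_sub_left, inner_smul_left, conj_trivial]
  rw [← hti, ← htj]
  ring

/-- By compactness a ray has a last point in `P`. For generic `p` the constraints tight there are
parallel and transversal to `v`, so that this point is flat. -/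
lemma IsPolytope.exists_dense_exit {P : Set 𝔼[n]} (hP : IsPolytope P) {v : 𝔼[n]} (hv : v ≠ 0) :
    ∃ D : Set 𝔼[n], Dense D ∧ ∀ p ∈ D, p ∈ P →
      ∃ t : ℝ, 0 ≤ t ∧ ∃ u, 0 < inner ℝ u v ∧ IsNormalAt P u (p + t • v) := by
  have hcomp := hP.isCompact
  obtain ⟨⟨k, Q, hQ, rfl⟩, -⟩ := hP
  choose K a b hab using fun j => (hQ j).1
  refine ⟨_, dense_transversal (ι := Σ j, Fin (K j)) (fun i => a i.1 i.2) (fun i => b i.1 i.2) v,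
    fun p hp hpP => ?_⟩
  set T : Set ℝ := Set.Ici 0 ∩ (fun t : ℝ => p + t • v) ⁻¹' (⋃ j, Q j) with hT
  have hTc : IsCompact T := by
    refine Metric.isCompact_of_isClosed_isBounded
      (isClosed_Ici.inter (hcomp.isClosed.preimage (by fun_prop))) ?_
    obtain ⟨R, hR⟩ := hcomp.isBounded.exists_norm_le
    refine (Metric.isBounded_Icc (0 : ℝ) ((R + ‖p‖) / ‖v‖)).subset ?_
    rintro t ⟨ht0, ht⟩
    refine ⟨ht0, ?_⟩
    rw [le_div_iff₀ (norm_pos_iff.mpr hv)]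
    have h1 : t * ‖v‖ = ‖t • v‖ := by rw [norm_smul, Real.norm_of_nonneg ht0]
    have h2 : t • v = (p + t • v) - p := by abel
    rw [h1, h2]
    exact (norm_sub_le _ _).trans (by gcongr; exact hR _ ht)
  obtain ⟨t, ⟨ht0, htP⟩, hmax⟩ := hTc.exists_isGreatest ⟨0, by simp, by simpa using hpP⟩
  refine ⟨t, ht0, exists_normal_of_exit a b hab (fun j => (hQ j).2.2) htP ?_ ?_⟩
  · intro s hs hmem
    have : t + s ∈ T := ⟨by simp only [Set.mem_Ici] at ht0 ⊢; linarith, by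
      simpa [add_smul, add_assoc] using hmem⟩
    linarith [hmax this]
  · intro j i j' i' h1 h2 h3 h4
    exact hp t ⟨j, i⟩ ⟨j', i'⟩ h1 h2 h3 h4

section Listed

variable {m : ℕ} {P : Set 𝔼[n]} {F : Fin m → Set 𝔼[n]}

/-- `u i` and `b i` are outward unit normal and offset of the facet `F i` of `P`. -/
structure AreFacetNormals (P : Set 𝔼[n]) (F : Fin m → Set 𝔼[n]) (u : Fin m → 𝔼[n]) (b : Fin m → ℝ) :
    Prop where
  norm_eq_one : ∀ i, ‖u i‖ = 1
  inner_eq : ∀ i, ∀ z ∈ F i, inner ℝ (u i) z = b i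
  isNormalAt : ∀ i, ∀ y ∈ flatPoints P,
    F i = closure (connectedComponentIn (flatPoints P) y) → IsNormalAt P (u i) y

lemma ListsFacets.exists_normals (hF : ListsFacets P F) : ∃ u b, AreFacetNormals P F u b := by
  have : ∀ i, F i ∈ facets P := fun i => hF.2 ▸ Set.mem_range_self i
  choose u b h1 h2 h3 using fun i => exists_facet_normal (this i)
  exact ⟨u, b, h1, h2, h3⟩

lemma flatPoints_subset (P : Set 𝔼[n]) : flatPoints P ⊆ P := by
  rintro y ⟨u, -, h⟩
  exact IsNormalAt.mem (u := u) h

lemma ListsFacets.subset (hF : ListsFacets P F) (hP : IsClosed P) (i : Fin m) : F i ⊆ P := by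
  obtain ⟨x, -, h⟩ : F i ∈ facets P := hF.2 ▸ Set.mem_range_self i
  rw [h]
  exact closure_minimal ((connectedComponentIn_subset _ _).trans (flatPoints_subset P)) hP

lemma ListsFacets.isCompact (hF : ListsFacets P F) (hP : IsCompact P) (i : Fin m) :
    IsCompact (F i) := by
  refine hP.of_isClosed_subset ?_ (hF.subset hP.isClosed i)
  obtain ⟨x, -, h⟩ : F i ∈ facets P := hF.2 ▸ Set.mem_range_self i
  rw [h]
  exact isClosed_closure

lemma ListsFacets.exists_mem (hF : ListsFacets P F) {y : 𝔼[n]} (hy : y ∈ flatPoints P) :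
    ∃ i, F i = closure (connectedComponentIn (flatPoints P) y) ∧ y ∈ F i := by
  have : closure (connectedComponentIn (flatPoints P) y) ∈ Set.range F := hF.2 ▸ ⟨y, hy, rfl⟩
  obtain ⟨i, hi⟩ := this
  exact ⟨i, hi, hi ▸ subset_closure (mem_connectedComponentIn hy)⟩

/-- From any point of a polytope one can move in direction `v` to a facet facing `v`. -/
lemma ListsFacets.exists_ray (hF : ListsFacets P F) (hP : IsPolytope P) {u : Fin m → 𝔼[n]}
    {b : Fin m → ℝ} (hu : AreFacetNormals P F u b) {v : 𝔼[n]} (hv : v ≠ 0) {p : 𝔼[n]} (hp : p ∈ P) :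
    ∃ i, 0 < inner ℝ (u i) v ∧ ∃ t : ℝ, 0 ≤ t ∧ p + t • v ∈ F i := by
  obtain ⟨R, hR⟩ := hP.isCompact.isBounded.exists_norm_le
  obtain ⟨D, hD, hDexit⟩ := hP.exists_dense_exit hv
  set T := 2 * R / ‖v‖
  -- `X` collects the points from which a facet facing `v` is reached within the time `T` needed to
  -- cross a ball of radius `R`. It is closed, so it contains all of `P` once it contains the
  -- generic interior points.
  set X : Set 𝔼[n] := ⋃ i : {i // 0 < inner ℝ (u i) v},
    (fun q : 𝔼[n] × ℝ => q.1 - q.2 • v) '' (F i ×ˢ Set.Icc 0 T) with hX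
  have hXc : IsClosed X := by
    refine isClosed_iUnion_of_finite fun i => IsCompact.isClosed ?_
    exact ((hF.isCompact hP.isCompact i).prod isCompact_Icc).image (by fun_prop)
  have hsub : interior P ∩ D ⊆ X := by
    rintro q ⟨hqP, hqD⟩
    obtain ⟨t, ht, w, hw, hn⟩ := hDexit q hqD (interior_subset hqP)
    have hflat : q + t • v ∈ flatPoints P := ⟨w, by rintro rfl; simp at hw, hn⟩
    obtain ⟨i, hi, hmem⟩ := hF.exists_mem hflat
    have hni := hu.isNormalAt i _ hflat hi
    have hw0 : w ≠ 0 := by rintro rfl; simp at hw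
    have hpos : 0 < inner ℝ (u i) v := by
      rw [hni.unique (hn.smul (c := ‖w‖⁻¹) (by positivity)) (hu.norm_eq_one i)
        (by simp [norm_smul, hw0]), inner_smul_left]
      simp only [conj_trivial]
      positivity
    refine Set.mem_iUnion.mpr ⟨⟨i, hpos⟩, (q + t • v, t), ⟨hmem, ht, ?_⟩, by simp⟩
    rw [le_div_iff₀ (norm_pos_iff.mpr hv)]
    have h1 : t * ‖v‖ = ‖t • v‖ := by rw [norm_smul, Real.norm_of_nonneg ht]
    have h2 : t • v = (q + t • v) - q := by abel
    rw [h1, h2]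
    refine (norm_sub_le _ _).trans ?_
    linarith [hR _ (interior_subset hqP), hR _ hn.mem]
  have hmem : p ∈ X := by
    have h1 := hP.subset_closure_interior hp
    have h2 : closure (interior P) ⊆ closure (interior P ∩ D) :=
      closure_minimal (hD.open_subset_closure_inter isOpen_interior) isClosed_closure
    exact closure_minimal hsub hXc (h2 h1)
  obtain ⟨⟨i, hi⟩, ⟨q, t⟩, ⟨hq, ht⟩, rfl⟩ := Set.mem_iUnion.mp hmem
  exact ⟨i, hi, t, ht.1, by simpa using hq⟩

end Listed

end PolytopeGeometry

/-! ### Area under orthogonal projection and the area inequality -/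

section Projection

variable {E : Type*} [NormedAddCommGroup E] [InnerProductSpace ℝ E]

/-- The orthogonal projection along a unit vector `u`. -/
noncomputable def projAlong (u : E) : E →ₗ[ℝ] E := LinearMap.id - (innerₗ E u).smulRight u

lemma projAlong_apply (u x : E) : projAlong u x = x - inner ℝ u x • u := by
  simp [projAlong]

lemma inner_projAlong {u : E} (hu : ‖u‖ = 1) (x y : E) :
    inner ℝ (projAlong u x) (projAlong u y) = inner ℝ x y - inner ℝ u x * inner ℝ u y := by
  simp only [projAlong_apply, inner_sub_left, inner_sub_right, inner_smul_left, inner_smul_right,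
    conj_trivial, real_inner_self_eq_norm_sq, hu, real_inner_comm u]
  ring

lemma sum_inner_sq_orthogonal [FiniteDimensional ℝ E] {w : E} (hw : ‖w‖ = 1) {ι : Type*}
    [Fintype ι] (e : OrthonormalBasis ι ℝ (ℝ ∙ w)ᗮ) (u : E) :
    ∑ i, inner ℝ u (e i : E) ^ 2 = ‖u‖ ^ 2 - inner ℝ w u ^ 2 := by
  have h1 : ∀ i, inner ℝ u (e i : E) = inner ℝ (e i) ((ℝ ∙ w)ᗮ.orthogonalProjectionOnto u) := by
    intro i
    rw [real_inner_comm, Submodule.inner_orthogonalProjectionOnto_eq_of_mem_left]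
  rw [Finset.sum_congr rfl fun i _ => congrArg (· ^ 2) (h1 i)]
  have h2 : ∑ i, inner ℝ (e i) ((ℝ ∙ w)ᗮ.orthogonalProjectionOnto u) ^ 2 =
      ‖(ℝ ∙ w)ᗮ.orthogonalProjectionOnto u‖ ^ 2 := by
    rw [← e.sum_sq_norm_inner_right]
    simp only [Real.norm_eq_abs, sq_abs]
  have h3 := Submodule.norm_sq_eq_add_norm_sq_projection u (ℝ ∙ w)
  have h4 : ‖(ℝ ∙ w).orthogonalProjectionOnto u‖ = |inner ℝ w u| := by
    have := Submodule.starProjection_unit_singleton ℝ hw u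
    rw [Submodule.starProjection_apply] at this
    rw [← Submodule.norm_coe, this, norm_smul, hw, mul_one, Real.norm_eq_abs]
  rw [h2, h3, h4, sq_abs]
  ring

/-- In an orthonormal basis `e` of the hyperplane, the Gram matrix is the identity minus the
rank-one matrix of the coefficients `⟪u, e i⟫`. The matrix determinant lemma gives `1 - ∑ ⟪u, e i⟫ ^
2`, which is `⟪u, w⟫ ^ 2` by Pythagoras. -/
lemma normDet_projAlong_sq [FiniteDimensional ℝ E] {u w : E} (hu : ‖u‖ = 1) (hw : ‖w‖ = 1) :
    (projAlong u ∘ₗ (ℝ ∙ w)ᗮ.subtype).normDet ^ 2 = inner ℝ u w ^ 2 := by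
  set e := stdOrthonormalBasis ℝ (ℝ ∙ w)ᗮ
  refine (LinearMap.normDet_sq_eq_det_gram _ e).trans ?_
  have h : (Matrix.gram ℝ fun i => (projAlong u ∘ₗ (ℝ ∙ w)ᗮ.subtype) (e i)) =
      1 + Matrix.replicateCol Unit (fun i => - inner ℝ u (e i : E)) *
        Matrix.replicateRow Unit (fun i => inner ℝ u (e i : E)) := by
    ext i j
    rw [Matrix.gram_apply]
    simp only [LinearMap.comp_apply, Submodule.subtype_apply, inner_projAlong hu]
    have := orthonormal_iff_ite.mp e.orthonormal i j
    rw [Submodule.coe_inner] at this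
    simp [this, Matrix.one_apply, Matrix.mul_apply, sub_eq_add_neg]
  rw [h, Matrix.det_one_add_replicateCol_mul_replicateRow]
  have := sum_inner_sq_orthogonal hw e u
  simp only [dotProduct, mul_neg, Finset.sum_neg_distrib, ← sq, this, hu, real_inner_comm u]
  ring

lemma normDet_projAlong [FiniteDimensional ℝ E] {u w : E} (hu : ‖u‖ = 1) (hw : ‖w‖ = 1) :
    (projAlong u ∘ₗ (ℝ ∙ w)ᗮ.subtype).normDet = |inner ℝ u w| := by
  have := (sq_eq_sq_iff_abs_eq_abs _ _).mp (normDet_projAlong_sq hu hw)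
  rwa [abs_of_nonneg (LinearMap.normDet_nonneg _)] at this

end Projection

lemma finrank_orthogonal_span_singleton_eq {n : ℕ} {w : 𝔼[n]} (hw : w ≠ 0) :
    Module.finrank ℝ (ℝ ∙ w)ᗮ = n - 1 := by
  have := (ℝ ∙ w).finrank_add_finrank_orthogonal
  rw [finrank_span_singleton hw, finrank_euclideanSpace, Fintype.card_fin] at this
  omega

lemma area_projAlong_image {n : ℕ} {u w : 𝔼[n]} (hu : ‖u‖ = 1) (hw : ‖w‖ = 1) {b : ℝ}
    {A : Set 𝔼[n]} (hA : ∀ x ∈ A, inner ℝ w x = b) :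
    area (projAlong u '' A) = ENNReal.ofReal |inner ℝ u w| * area A := by
  have hw0 : w ≠ 0 := by rintro rfl; simp at hw
  set K := (ℝ ∙ w)ᗮ
  set A' : Set K := (fun k : K => (k : 𝔼[n]) + b • w) ⁻¹' A with hA'
  have hAA' : A = (fun k : K => (k : 𝔼[n]) + b • w) '' A' := by
    ext x
    constructor
    · intro hx
      have hxK : x - b • w ∈ K := by
        rw [Submodule.mem_orthogonal_singleton_iff_inner_right, inner_sub_right, hA x hx,
          inner_smul_right, real_inner_self_eq_norm_sq, hw]
        ring
      exact ⟨⟨_, hxK⟩, by simpa [hA'] using hx, by simp⟩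
    · rintro ⟨k, hk, rfl⟩
      exact hk
  have hiso : Isometry (fun k : K => (k : 𝔼[n]) + b • w) :=
    (isometry_add_right (b • w)).comp K.subtypeₗᵢ.isometry
  have h1 : area A = μHE[n - 1] A' := by
    conv_lhs => rw [hAA']
    exact hiso.euclideanHausdorffMeasure_image _
  have h2 : projAlong u '' A = (fun x => x + projAlong u (b • w)) ''
      ((projAlong u ∘ₗ K.subtype) '' A') := by
    conv_lhs => rw [hAA']
    rw [Set.image_image, Set.image_image]
    simp
  have hK := finrank_orthogonal_span_singleton_eq hw0
  rw [h1, h2, area, (isometry_add_right (projAlong u (b • w))).euclideanHausdorffMeasure_image,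
    ← normDet_projAlong hu hw, ← hK]
  exact LinearMap.euclideanHausdorffMeasure_image _ _

/-- The facets hit by rays in direction `-u l` have projections along `u l` that cover the
projection of `F l`, which has the same area as `F l`. `ENNReal.ofReal` truncates the weights of all
other facets to zero. -/
lemma ListsFacets.area_le_sum {n m : ℕ} {P : Set 𝔼[n]} {F : Fin m → Set 𝔼[n]}
    (hF : ListsFacets P F) (hP : IsPolytope P) {u : Fin m → 𝔼[n]} {b : Fin m → ℝ}
    (hu : AreFacetNormals P F u b) (l : Fin m) :
    area (F l) ≤ ∑ i, ENNReal.ofReal (- inner ℝ (u i) (u l)) * area (F i) := by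
  classical
  have hul : u l ≠ 0 := by intro h; simpa [h] using hu.norm_eq_one l
  set I := Finset.univ.filter fun i => 0 < inner ℝ (u i) (-u l) with hI
  have hcov : projAlong (u l) '' F l ⊆ ⋃ i ∈ I, projAlong (u l) '' F i := by
    rintro _ ⟨x, hx, rfl⟩
    obtain ⟨i, hi, t, -, ht⟩ := hF.exists_ray hP hu (neg_ne_zero.mpr hul)
      (hF.subset hP.isCompact.isClosed l hx)
    refine Set.mem_biUnion (x := i) (by simpa [hI] using hi) ⟨_, ht, ?_⟩
    simp [projAlong_apply, inner_add_right, inner_smul_right, hu.norm_eq_one, add_smul]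
  have hl : area (projAlong (u l) '' F l) = area (F l) := by
    rw [area_projAlong_image (hu.norm_eq_one l) (hu.norm_eq_one l) (hu.inner_eq l)]
    simp [hu.norm_eq_one]
  calc area (F l) = area (projAlong (u l) '' F l) := hl.symm
    _ ≤ area (⋃ i ∈ I, projAlong (u l) '' F i) := MeasureTheory.measure_mono hcov
    _ ≤ ∑ i ∈ I, area (projAlong (u l) '' F i) := MeasureTheory.measure_biUnion_finset_le _ _
    _ = ∑ i ∈ I, ENNReal.ofReal (- inner ℝ (u i) (u l)) * area (F i) := by
      refine Finset.sum_congr rfl fun i hi => ?_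
      rw [area_projAlong_image (hu.norm_eq_one l) (hu.norm_eq_one i) (hu.inner_eq i)]
      simp only [hI, Finset.mem_filter, Finset.mem_univ, true_and, inner_neg_right] at hi
      rw [abs_of_neg (by rw [real_inner_comm]; linarith), real_inner_comm]
    _ ≤ _ := Finset.sum_le_sum_of_subset (Finset.subset_univ _)

/-- The index `l` drops out of the sum because its own weight is `max 0 (-1) = 0`. -/
lemma ListsFacets.real_le_sum {n m : ℕ} {P : Set 𝔼[n]} {F : Fin m → Set 𝔼[n]}
    (hF : ListsFacets P F) (hP : IsPolytope P) {u : Fin m → 𝔼[n]} {b : Fin m → ℝ}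
    (hu : AreFacetNormals P F u b) {S : Fin m → ℝ} (hS : ∀ i, 0 ≤ S i)
    (hFS : ∀ i, area (F i) = ENNReal.ofReal (S i)) (l : Fin m) :
    S l ≤ ∑ i ∈ Finset.univ.erase l, max 0 (- inner ℝ (u i) (u l)) * S i := by
  have h := hF.area_le_sum hP hu l
  have h1 : ∀ i, ENNReal.ofReal (- inner ℝ (u i) (u l)) * area (F i) =
      ENNReal.ofReal (max 0 (- inner ℝ (u i) (u l)) * S i) := by
    intro i
    rw [hFS, ENNReal.ofReal_mul (le_max_left _ _)]
    simp
  have h2 : ∀ i, 0 ≤ max 0 (- inner ℝ (u i) (u l)) * S i :=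
    fun i => mul_nonneg (le_max_left _ _) (hS i)
  simp_rw [h1] at h
  rw [← ENNReal.ofReal_sum_of_nonneg fun i _ => h2 i, hFS,
    ENNReal.ofReal_le_ofReal_iff (Finset.sum_nonneg fun i _ => h2 i),
    ← Finset.add_sum_erase _ _ (Finset.mem_univ l)] at h
  simpa [hu.norm_eq_one] using h

/-- In a polytope the largest facet is strictly smaller than all others together. -/
theorem ListsFacets.area_lt_sum {n m : ℕ} (hn : 2 ≤ n) {P : Set 𝔼[n]} {F : Fin m → Set 𝔼[n]}
    (hF : ListsFacets P F) (hP : IsPolytope P) {S : Fin m → ℝ} (hS : ∀ i, 0 < S i)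
    (hFS : ∀ i, area (F i) = ENNReal.ofReal (S i)) (l : Fin m) :
    S l < ∑ i ∈ Finset.univ.erase l, S i := by
  obtain ⟨u, b, hu⟩ := hF.exists_normals
  refine (hF.real_le_sum hP hu (fun i => (hS i).le) hFS l).trans_lt ?_
  have hbound : ∀ i, max 0 (- inner ℝ (u i) (u l)) ≤ 1 := by
    intro i
    have := abs_real_inner_le_norm (u i) (u l)
    rw [hu.norm_eq_one, hu.norm_eq_one, mul_one] at this
    exact max_le zero_le_one (by linarith [neg_abs_le (inner ℝ (u i) (u l))])
  have hle : ∀ i, max 0 (- inner ℝ (u i) (u l)) * S i ≤ S i :=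
    fun i => mul_le_of_le_one_left (hS i).le (hbound i)
  by_contra hcon
  -- Without a strict inequality every weight is `1`, the equality case of Cauchy–Schwarz.
  have heq : ∀ i ≠ l, u i = - u l := by
    intro i hi
    by_contra hne
    refine hcon (Finset.sum_lt_sum (fun i _ => hle i) ⟨i, by simp [hi], ?_⟩)
    have h1 : - inner ℝ (u i) (u l) < 1 := by
      rw [← inner_neg_right]
      refine lt_of_le_of_ne ?_ fun h => hne ?_
      · have := hbound i
        rw [inner_neg_right]
        exact (le_max_right _ _).trans this
      · exact (inner_eq_one_iff_of_norm_eq_one (hu.norm_eq_one i)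
          (by simp [hu.norm_eq_one])).mp h
    exact mul_lt_of_lt_one_left (hS i) (max_lt zero_lt_one h1)
  have hul : u l ≠ 0 := by intro h; simpa [h] using hu.norm_eq_one l
  -- Since `n ≥ 2`, there is a nonzero `v` orthogonal to `u l`. No facet faces it, contrary to
  -- `exists_ray`.
  have hpos : 0 < Module.finrank ℝ (ℝ ∙ u l)ᗮ := by
    rw [finrank_orthogonal_span_singleton_eq hul]; omega
  obtain ⟨⟨v, hv⟩, hv0⟩ := Module.finrank_pos_iff_exists_ne_zero.mp hpos
  rw [Submodule.mem_orthogonal_singleton_iff_inner_right] at hv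
  obtain ⟨p, hp⟩ := hP.2.nonempty
  obtain ⟨i, hi, -⟩ := hF.exists_ray hP hu (v := v) (by simpa using hv0) hp
  by_cases h : i = l
  · subst h; linarith
  · rw [heq i h, inner_neg_left, hv] at hi
    simp at hi

/-- Transfers approximate coverings to the limit by a three-epsilon argument. The index `j` may vary
with the point. -/
lemma subset_closure_iUnion_of_tendsto_hausdorffEDist {α ι : Type*} [PseudoEMetricSpace α]
    {A : Set α} {Ak : ℕ → Set α} {B : ι → Set α} {Bk : ℕ → ι → Set α}
    (hA : Filter.Tendsto (fun k => Metric.hausdorffEDist (Ak k) A) Filter.atTop (𝓝 0))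
    (hB : ∀ j, Filter.Tendsto (fun k => Metric.hausdorffEDist (Bk k j) (B j)) Filter.atTop (𝓝 0))
    [Finite ι]
    (h : ∀ ε : ENNReal, 0 < ε → ∀ᶠ k in Filter.atTop, ∀ x ∈ Ak k, ∃ j,
      Metric.infEDist x (Bk k j) ≤ ε) :
    A ⊆ closure (⋃ j, B j) := by
  intro p hp
  rw [Metric.mem_closure_iff_infEDist_zero]
  refine le_antisymm (ENNReal.le_of_forall_pos_le_add fun ε hε _ => ?_) bot_le
  have hε3 : (0 : ENNReal) < ε / 3 := ENNReal.div_pos (by simpa using hε.ne') (by simp)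
  have hB' : ∀ᶠ k in Filter.atTop, ∀ j, Metric.hausdorffEDist (Bk k j) (B j) < ε / 3 :=
    Filter.eventually_all.mpr fun j => (hB j).eventually_lt_const hε3
  obtain ⟨k, h1, h2, h3⟩ := ((hA.eventually_lt_const hε3).and (hB'.and (h _ hε3))).exists
  rw [Metric.hausdorffEDist_comm] at h1
  obtain ⟨p', hp', hpp'⟩ := Metric.exists_edist_lt_of_hausdorffEDist_lt hp h1
  obtain ⟨j, hj⟩ := h3 p' hp'
  calc Metric.infEDist p (⋃ j, B j) ≤ Metric.infEDist p (B j) :=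
        Metric.infEDist_anti (Set.subset_iUnion _ j)
    _ ≤ Metric.infEDist p' (B j) + edist p p' := Metric.infEDist_le_infEDist_add_edist
    _ ≤ (Metric.infEDist p' (Bk k j) + Metric.hausdorffEDist (Bk k j) (B j)) + edist p p' := by
        gcongr; exact Metric.infEDist_le_infEDist_add_hausdorffEDist
    _ ≤ (ε / 3 + ε / 3) + ε / 3 := by gcongr; exact (h2 j).le
    _ = 0 + ε := by rw [ENNReal.add_thirds, zero_add]

/-! ### Thin polytopes: height estimates -/

section Heights

variable {n m : ℕ} {P : Set 𝔼[n]} {F : Fin m → Set 𝔼[n]} {u : Fin m → 𝔼[n]} {b : Fin m → ℝ}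

/-- Moving along `v` does not change the height `⟪w, ·⟫`, so every height in `P` already occurs on a
facet. The heights of the connected set `P` form an interval, covered by finitely many sets of
diameter at most `δ i`; comparing Lebesgue measures gives the bound. -/
lemma ListsFacets.height_le (hF : ListsFacets P F) (hP : IsPolytope P)
    (hu : AreFacetNormals P F u b) {w v : 𝔼[n]} (hv : v ≠ 0) (hwv : inner ℝ w v = 0)
    {δ : Fin m → ℝ} (hδ0 : ∀ i, 0 ≤ δ i)
    (hδ : ∀ i, ∀ x ∈ F i, ∀ y ∈ F i, |inner ℝ w x - inner ℝ w y| ≤ δ i)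
    {p q : 𝔼[n]} (hp : p ∈ P) (hq : q ∈ P) : |inner ℝ w p - inner ℝ w q| ≤ ∑ i, δ i := by
  set g : 𝔼[n] → ℝ := fun x => inner ℝ w x
  have hcover : g '' P ⊆ ⋃ i, g '' F i := by
    rintro _ ⟨x, hx, rfl⟩
    obtain ⟨i, -, t, -, ht⟩ := hF.exists_ray hP hu hv hx
    exact Set.mem_iUnion.mpr ⟨i, _, ht, by simp [g, inner_add_right, inner_smul_right, hwv]⟩
  have hconn : (g '' P).OrdConnected :=
    (hP.2.isPreconnected.image g (by fun_prop)).ordConnected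
  have h1 : MeasureTheory.volume (Set.uIcc (g q) (g p)) ≤ ENNReal.ofReal (∑ i, δ i) := by
    calc MeasureTheory.volume (Set.uIcc (g q) (g p))
        ≤ MeasureTheory.volume (⋃ i, g '' F i) := MeasureTheory.measure_mono
          ((hconn.uIcc_subset ⟨q, hq, rfl⟩ ⟨p, hp, rfl⟩).trans hcover)
      _ ≤ ∑ i, MeasureTheory.volume (g '' F i) := MeasureTheory.measure_iUnion_fintype_le _ _
      _ ≤ ∑ i, ENNReal.ofReal (δ i) := by
        refine Finset.sum_le_sum fun i _ => (Real.volume_le_diam _).trans ?_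
        refine Metric.ediam_le ?_
        rintro _ ⟨x, hx, rfl⟩ _ ⟨y, hy, rfl⟩
        rw [edist_dist, Real.dist_eq]
        exact ENNReal.ofReal_le_ofReal (hδ i x hx y hy)
      _ = _ := (ENNReal.ofReal_sum_of_nonneg fun i _ => hδ0 i).symm
  rwa [Real.volume_interval, ENNReal.ofReal_le_ofReal_iff (Finset.sum_nonneg fun i _ => hδ0 i)] at h1

/-- Only `F l` faces upwards, so the vertical ray from `p` must end on it, and its length is a
difference of heights. -/
lemma ListsFacets.exists_near_top (hF : ListsFacets P F) (hP : IsPolytope P)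
    (hu : AreFacetNormals P F u b) {l : Fin m} (hl : ∀ i ≠ l, inner ℝ (u i) (u l) < 0)
    {H : ℝ} (hH : ∀ p ∈ P, ∀ q ∈ P, |inner ℝ (u l) p - inner ℝ (u l) q| ≤ H) {p : 𝔼[n]}
    (hp : p ∈ P) : ∃ q ∈ F l, dist p q ≤ H := by
  have hul : u l ≠ 0 := by intro h; simpa [h] using hu.norm_eq_one l
  obtain ⟨i, hi, t, ht, hmem⟩ := hF.exists_ray hP hu hul hp
  obtain rfl : i = l := by by_contra h; linarith [hl i h]
  refine ⟨_, hmem, ?_⟩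
  have := hH _ (hF.subset hP.isCompact.isClosed _ hmem) _ hp
  rw [inner_add_right, inner_smul_right, real_inner_self_eq_norm_sq, hu.norm_eq_one] at this
  rw [dist_self_add_right, norm_smul, hu.norm_eq_one, mul_one, Real.norm_eq_abs]
  convert this using 2
  ring

lemma ListsFacets.exists_near_bottom (hF : ListsFacets P F) (hP : IsPolytope P)
    (hu : AreFacetNormals P F u b) {l : Fin m}
    {H : ℝ} (hH : ∀ p ∈ P, ∀ q ∈ P, |inner ℝ (u l) p - inner ℝ (u l) q| ≤ H) {p : 𝔼[n]}
    (hp : p ∈ P) : ∃ i ≠ l, ∃ q ∈ F i, dist p q ≤ H := by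
  have hul : u l ≠ 0 := by intro h; simpa [h] using hu.norm_eq_one l
  obtain ⟨i, hi, t, ht, hmem⟩ := hF.exists_ray hP hu (neg_ne_zero.mpr hul) hp
  refine ⟨i, ?_, _, hmem, ?_⟩
  · rintro rfl
    rw [inner_neg_right, real_inner_self_eq_norm_sq, hu.norm_eq_one] at hi
    linarith
  have := hH _ (hF.subset hP.isCompact.isClosed _ hmem) _ hp
  rw [inner_add_right, inner_smul_right, inner_neg_right, real_inner_self_eq_norm_sq,
    hu.norm_eq_one] at this
  rw [dist_self_add_right, norm_smul, norm_neg, hu.norm_eq_one, mul_one, Real.norm_eq_abs,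
    ← abs_neg]
  convert this using 2
  ring

end Heights

lemma tendsto_bound_of_tendsto_hausdorffEDist {E : Type*} [SeminormedAddCommGroup E] {P : Set E}
    {Pk : ℕ → Set E} (hP : Bornology.IsBounded P)
    (h : Filter.Tendsto (fun k => Metric.hausdorffEDist (Pk k) P) Filter.atTop (𝓝 0)) :
    ∃ R : ℝ, 0 < R ∧ ∀ᶠ k in Filter.atTop, ∀ x ∈ Pk k, ‖x‖ ≤ R := by
  obtain ⟨R, hR0, hR⟩ := hP.exists_pos_norm_le
  refine ⟨R + 1, by linarith, ?_⟩
  filter_upwards [h.eventually_lt_const zero_lt_one] with k hk x hx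
  obtain ⟨y, hy, hxy⟩ := Metric.exists_edist_lt_of_hausdorffEDist_lt hx hk
  have hd : dist x y < 1 := by
    rw [edist_dist, ENNReal.ofReal_lt_one] at hxy
    exact hxy
  rw [dist_eq_norm] at hd
  have : x = y + (x - y) := by abel
  rw [this]
  exact (norm_add_le _ _).trans (add_le_add (hR y hy) hd.le)

/-! ### Limiting positions and the case of equality -/

section Limits

variable {n m : ℕ} {P : Set 𝔼[n]} {F : Fin m → Set 𝔼[n]} {S : Fin m → ℝ} {l : Fin m}

lemma IsDoublyCountedFacet.area_eq_sum (h : IsDoublyCountedFacet P F l)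
    (hFc : ∀ i, IsCompact (F i)) : area (F l) = ∑ i ∈ Finset.univ.erase l, area (F i) := by
  obtain ⟨-, h2, h3⟩ := h
  have : F l = ⋃ i ∈ Finset.univ.erase l, F i := by
    conv_lhs => rw [h2]
    simp
  conv_lhs => rw [this]
  refine MeasureTheory.measure_biUnion_finset₀ ?_ fun i _ =>
    (hFc i).isClosed.measurableSet.nullMeasurableSet
  intro i hi j hj hij
  exact h3 i j (by simpa using hi) (by simpa using hj) hij

/-- Removing `F j` from `F i` keeps the covering of `F l`, so the removed part cannot have
contributed to the sum. -/
lemma area_inter_eq_zero_of_area_eq_sum (hFc : ∀ i, IsCompact (F i))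
    (hfin : area (F l) ≠ ⊤) (hcov : F l = ⋃ i, ⋃ (_ : i ≠ l), F i)
    (hsum : area (F l) = ∑ i ∈ Finset.univ.erase l, area (F i)) {i j : Fin m} (hi : i ≠ l)
    (hj : j ≠ l) (hij : i ≠ j) : area (F i ∩ F j) = 0 := by
  have hil : i ∈ Finset.univ.erase l := by simpa using hi
  have hsub : F l ⊆ (⋃ k ∈ (Finset.univ.erase l).erase i, F k) ∪ (F i \ F j) := by
    intro x hx
    rw [hcov] at hx
    simp only [Set.mem_iUnion] at hx
    obtain ⟨k, hk, hxk⟩ := hx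
    by_cases hki : k = i
    · subst hki
      by_cases hxj : x ∈ F j
      · exact Or.inl (Set.mem_biUnion (x := j) (by simp [hj, hij.symm]) hxj)
      · exact Or.inr ⟨hxk, hxj⟩
    · exact Or.inl (Set.mem_biUnion (x := k) (by simp [hk, hki]) hxk)
  have h1 : area (F l) ≤ ∑ k ∈ (Finset.univ.erase l).erase i, area (F k) + area (F i \ F j) :=
    (MeasureTheory.measure_mono hsub).trans ((MeasureTheory.measure_union_le _ _).trans
      (add_le_add_left (MeasureTheory.measure_biUnion_finset_le _ _) _))
  have h2 : area (F i) = area (F i ∩ F j) + area (F i \ F j) :=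
    (MeasureTheory.measure_inter_add_sdiff _ (hFc j).isClosed.measurableSet).symm
  rw [hsum] at h1 hfin
  have h3 := Finset.add_sum_erase _ (fun k => area (F k)) hil
  rw [← h3, h2] at h1
  set X := ∑ k ∈ (Finset.univ.erase l).erase i, area (F k)
  set Y := area (F i \ F j)
  have hXY : X + Y ≠ ⊤ := by
    refine ne_top_of_le_ne_top hfin ?_
    rw [← h3, h2, add_comm X Y]
    gcongr
    exact le_add_self
  have h4 : area (F i ∩ F j) + (X + Y) ≤ 0 + (X + Y) := by
    rw [zero_add]
    calc _ = area (F i ∩ F j) + Y + X := by ring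
      _ ≤ X + Y := h1
  simpa using (ENNReal.add_le_add_iff_right hXY).mp h4


/-- The class `C` is a parameter, so that general and convex polytopes are treated at once. The
weights `c k i` of the area inequality measure how close the normals are to being opposite. -/
theorem IsLimitingPosition.le_sum_and_eq_iff {C : Set 𝔼[n] → Prop} (hn : 2 ≤ n)
    (hC : ∀ Q, C Q → IsPolytope Q) (h : IsLimitingPosition C P F) (hS : ∀ i, 0 < S i)
    (hFS : ∀ i, area (F i) = ENNReal.ofReal (S i)) :
    S l ≤ ∑ i ∈ Finset.univ.erase l, S i ∧
      (S l = ∑ i ∈ Finset.univ.erase l, S i ↔ IsDoublyCountedFacet P F l) := by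
  obtain ⟨hPc, hFc, Pk, Fk, hk, hPk, hFk⟩ := h
  have hPoly : ∀ k, IsPolytope (Pk k) := fun k => hC _ (hk k).1
  choose u b hu using fun k => (hk k).2.exists_normals
  set Sk : ℕ → Fin m → ℝ := fun k i => (area (Fk k i)).toReal
  have hSk : ∀ i, Filter.Tendsto (fun k => Sk k i) Filter.atTop (𝓝 (S i)) := by
    intro i
    have h1 := (ENNReal.tendsto_toReal (by rw [hFS]; exact ENNReal.ofReal_ne_top)).comp (hFk i).2
    rwa [hFS, ENNReal.toReal_ofReal (hS i).le] at h1
  -- `toReal` sends an infinite area to `0`, so `Sk` represents the areas only once these are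
  -- finite.
  have hfin : ∀ᶠ k in Filter.atTop, ∀ i, area (Fk k i) = ENNReal.ofReal (Sk k i) := by
    rw [Filter.eventually_all]
    intro i
    have : area (F i) < ⊤ := by rw [hFS]; exact ENNReal.ofReal_lt_top
    filter_upwards [(hFk i).2.eventually_lt_const this] with k hk
    exact (ENNReal.ofReal_toReal hk.ne).symm
  have hSk0 : ∀ k i, 0 ≤ Sk k i := fun k i => ENNReal.toReal_nonneg
  set c : ℕ → Fin m → ℝ := fun k i => max 0 (- inner ℝ (u k i) (u k l))
  have hc1 : ∀ k i, c k i ≤ 1 := by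
    intro k i
    have := abs_real_inner_le_norm (u k i) (u k l)
    rw [(hu k).norm_eq_one, (hu k).norm_eq_one, mul_one] at this
    exact max_le zero_le_one (by linarith [neg_abs_le (inner ℝ (u k i) (u k l))])
  have hineq : ∀ᶠ k in Filter.atTop, Sk k l ≤ ∑ i ∈ Finset.univ.erase l, c k i * Sk k i := by
    filter_upwards [hfin] with k hk'
    exact (hk k).2.real_le_sum (hPoly k) (hu k) (hSk0 k) hk' l
  have hsumT : Filter.Tendsto (fun k => ∑ i ∈ Finset.univ.erase l, Sk k i) Filter.atTop
      (𝓝 (∑ i ∈ Finset.univ.erase l, S i)) := tendsto_finsetSum _ fun i _ => hSk i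
  refine ⟨?_, fun heq => ?_, fun hd => ?_⟩
  · refine le_of_tendsto_of_tendsto (hSk l) hsumT ?_
    filter_upwards [hineq] with k hk'
    exact hk'.trans (Finset.sum_le_sum fun i _ => mul_le_of_le_one_left (hSk0 k i) (hc1 k i))
  -- Each loss `(1 - c k i) * Sk k i` is nonnegative, and together they are at most the gap between
  -- the two sides, which tends to `0`. As `Sk k i` tends to `S i > 0`, the weights tend to `1`.
  · have hdef : ∀ i ≠ l, Filter.Tendsto (fun k => (1 - c k i) * Sk k i) Filter.atTop (𝓝 0) := by
      intro i hi
      have h0 : Filter.Tendsto (fun k => ∑ i ∈ Finset.univ.erase l, Sk k i - Sk k l) Filter.atTop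
          (𝓝 0) := by
        have := hsumT.sub (hSk l)
        rwa [heq, sub_self] at this
      refine tendsto_of_tendsto_of_tendsto_of_le_of_le' tendsto_const_nhds h0
        (Filter.Eventually.of_forall fun k => mul_nonneg (by linarith [hc1 k i]) (hSk0 k i)) ?_
      filter_upwards [hineq] with k hk'
      have h1 : (1 - c k i) * Sk k i ≤ ∑ i ∈ Finset.univ.erase l, (1 - c k i) * Sk k i :=
        Finset.single_le_sum (f := fun i => (1 - c k i) * Sk k i)
          (fun j _ => mul_nonneg (by linarith [hc1 k j]) (hSk0 k j)) (by simpa using hi)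
      have h2 : ∑ i ∈ Finset.univ.erase l, (1 - c k i) * Sk k i =
          ∑ i ∈ Finset.univ.erase l, Sk k i - ∑ i ∈ Finset.univ.erase l, c k i * Sk k i := by
        rw [← Finset.sum_sub_distrib]
        exact Finset.sum_congr rfl fun _ _ => by ring
      linarith
    have hcT : ∀ i ≠ l, Filter.Tendsto (fun k => c k i) Filter.atTop (𝓝 1) := by
      intro i hi
      have h1 := (hdef i hi).div (hSk i) (hS i).ne'
      have h2 : Filter.Tendsto (fun k => 1 - (1 - c k i) * Sk k i / Sk k i) Filter.atTop (𝓝 1) := by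
        simpa using tendsto_const_nhds.sub h1
      refine h2.congr' ?_
      filter_upwards [(hSk i).eventually_const_lt (hS i)] with k hk'
      rw [mul_div_cancel_right₀ _ hk'.ne']
      ring
    have hneg : ∀ᶠ k in Filter.atTop, ∀ i ≠ l, 0 < c k i :=
      Filter.eventually_all.mpr fun i => by
        by_cases hi : i = l
        · exact Filter.Eventually.of_forall fun k h => absurd hi h
        · exact ((hcT i hi).eventually_const_lt zero_lt_one).mono fun k h _ => h
    obtain ⟨R, hR0, hR⟩ := tendsto_bound_of_tendsto_hausdorffEDist hPc.isBounded hPk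
    -- On `Fk k i` the function `⟪u k i, ·⟫` is constant, so `⟪u k l, ·⟫` varies like `⟪u k i + u k
    -- l, ·⟫`. The norm of that vector is `√(2 - 2 * c k i)`, and `2 * R` bounds the diameter.
    set δ : ℕ → Fin m → ℝ := fun k i => if i = l then 0 else √(2 - 2 * c k i) * (2 * R)
    have hδ0 : ∀ k i, 0 ≤ δ k i := by
      intro k i
      simp only [δ]
      split_ifs
      · exact le_rfl
      · positivity
    have hδT : Filter.Tendsto (fun k => ∑ i, δ k i) Filter.atTop (𝓝 0) := by
      rw [show (0 : ℝ) = ∑ i : Fin m, (0 : ℝ) by simp]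
      refine tendsto_finsetSum _ fun i _ => ?_
      simp only [δ]
      split_ifs with hi
      · exact tendsto_const_nhds
      · have h1 : Filter.Tendsto (fun k => √(2 - 2 * c k i) * (2 * R)) Filter.atTop
            (𝓝 (√(2 - 2 * 1) * (2 * R))) :=
          ((Real.continuous_sqrt.tendsto _).comp
            (tendsto_const_nhds.sub ((hcT i hi).const_mul 2))).mul_const _
        simpa using h1
    have hosc : ∀ᶠ k in Filter.atTop, ∀ i, ∀ x ∈ Fk k i, ∀ y ∈ Fk k i,
        |inner ℝ (u k l) x - inner ℝ (u k l) y| ≤ δ k i := by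
      filter_upwards [hneg, hR] with k hneg hR i x hx y hy
      simp only [δ]
      split_ifs with hi
      · subst hi
        rw [(hu k).inner_eq i x hx, (hu k).inner_eq i y hy, sub_self, abs_zero]
      · have hci : c k i = - inner ℝ (u k i) (u k l) := by
          rcases max_choice 0 (- inner ℝ (u k i) (u k l)) with h | h
          · exact absurd h (hneg i hi).ne'
          · exact h
        have h1 : inner ℝ (u k l) x - inner ℝ (u k l) y = inner ℝ (u k i + u k l) (x - y) := by
          rw [inner_add_left, inner_sub_right, inner_sub_right, (hu k).inner_eq i x hx,
            (hu k).inner_eq i y hy]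
          ring
        have h2 : ‖u k i + u k l‖ = √(2 - 2 * c k i) := by
          rw [eq_comm, Real.sqrt_eq_iff_eq_sq (by linarith [hc1 k i]) (norm_nonneg _),
            norm_add_sq_real, (hu k).norm_eq_one, (hu k).norm_eq_one, hci]
          ring
        have hsub := (hk k).2.subset (hPoly k).isCompact.isClosed i
        rw [h1, ← h2]
        refine (abs_real_inner_le_norm _ _).trans ?_
        gcongr
        refine (norm_sub_le _ _).trans ?_
        linarith [hR x (hsub hx), hR y (hsub hy)]
    have hheight : ∀ᶠ k in Filter.atTop, ∀ p ∈ Pk k, ∀ q ∈ Pk k,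
        |inner ℝ (u k l) p - inner ℝ (u k l) q| ≤ ∑ i, δ k i := by
      filter_upwards [hosc] with k hk' p hp q hq
      have hul : u k l ≠ 0 := by intro h; simpa [h] using (hu k).norm_eq_one l
      have hpos : 0 < Module.finrank ℝ (ℝ ∙ u k l)ᗮ := by
        rw [finrank_orthogonal_span_singleton_eq hul]; omega
      obtain ⟨⟨v, hv⟩, hv0⟩ := Module.finrank_pos_iff_exists_ne_zero.mp hpos
      rw [Submodule.mem_orthogonal_singleton_iff_inner_right] at hv
      exact (hk k).2.height_le (hPoly k) (hu k) (v := v) (by simpa using hv0) hv (hδ0 k) hk' hp hq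
    have hsmall : ∀ ε : ENNReal, 0 < ε → ∀ᶠ k in Filter.atTop,
        ENNReal.ofReal (∑ i, δ k i) ≤ ε := by
      intro ε hε
      have := ENNReal.tendsto_ofReal hδT
      rw [ENNReal.ofReal_zero] at this
      exact (this.eventually_lt_const hε).mono fun _ h => h.le
    have hle : ∀ {k p q} {A : Set 𝔼[n]}, q ∈ A → dist p q ≤ ∑ i, δ k i →
        Metric.infEDist p A ≤ ENNReal.ofReal (∑ i, δ k i) := by
      intro k p q A hq h
      refine (Metric.infEDist_le_edist_of_mem hq).trans ?_
      rw [edist_dist]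
      exact ENNReal.ofReal_le_ofReal h
    have hPl : P ⊆ F l := by
      have := subset_closure_iUnion_of_tendsto_hausdorffEDist (ι := Unit) (B := fun _ => F l)
        (Bk := fun k _ => Fk k l) hPk (fun _ => (hFk l).1) (by
          intro ε hε
          filter_upwards [hheight, hsmall ε hε, hneg] with k h1 h2 h3 p hp
          obtain ⟨q, hq, hpq⟩ := (hk k).2.exists_near_top (hPoly k) (hu k) (l := l)
            (fun i hi => by
              have := h3 i hi
              simp only [c, lt_max_iff, lt_self_iff_false, false_or] at this
              linarith) h1 hp
          exact ⟨(), (hle hq hpq).trans h2⟩)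
      rwa [Set.iUnion_const, (hFc l).isClosed.closure_eq] at this
    have hPU : P ⊆ ⋃ i, ⋃ (_ : i ≠ l), F i := by
      have := subset_closure_iUnion_of_tendsto_hausdorffEDist (ι := {i // i ≠ l})
        (B := fun i => F i) (Bk := fun k i => Fk k i) hPk (fun i => (hFk i).1) (by
          intro ε hε
          filter_upwards [hheight, hsmall ε hε] with k h1 h2 p hp
          obtain ⟨i, hi, q, hq, hpq⟩ := (hk k).2.exists_near_bottom (hPoly k) (hu k) (l := l) h1 hp
          exact ⟨⟨i, hi⟩, (hle hq hpq).trans h2⟩)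
      rwa [(isClosed_iUnion_of_finite fun i : {i // i ≠ l} => (hFc i).isClosed).closure_eq,
        Set.iUnion_subtype] at this
    have hFP : ∀ i, F i ⊆ P := by
      intro i
      have := subset_closure_iUnion_of_tendsto_hausdorffEDist (ι := Unit) (B := fun _ => P)
        (Bk := fun k _ => Pk k) (hFk i).1 (fun _ => hPk) (by
          intro ε hε
          refine Filter.Eventually.of_forall fun k x hx => ⟨(), ?_⟩
          rw [Metric.infEDist_zero_of_mem ((hk k).2.subset (hPoly k).isCompact.isClosed i hx)]
          exact bot_le)
      rwa [Set.iUnion_const, hPc.isClosed.closure_eq] at this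
    have hPF : P = F l := Set.Subset.antisymm hPl (hFP l)
    have hcov : F l = ⋃ i, ⋃ (_ : i ≠ l), F i :=
      Set.Subset.antisymm (hPF ▸ hPU)
        (Set.iUnion_subset fun i => Set.iUnion_subset fun _ => hPF ▸ hFP i)
    refine ⟨hPF, hcov, fun i j hi hj hij => ?_⟩
    refine area_inter_eq_zero_of_area_eq_sum hFc (by rw [hFS]; exact ENNReal.ofReal_ne_top) hcov
      ?_ hi hj hij
    simp_rw [hFS]
    rw [heq, ENNReal.ofReal_sum_of_nonneg fun i _ => (hS i).le]
  · have := hd.area_eq_sum hFc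
    simp_rw [hFS] at this
    rwa [← ENNReal.ofReal_sum_of_nonneg fun i _ => (hS i).le, ENNReal.ofReal_eq_ofReal_iff (hS l).le
      (Finset.sum_nonneg fun i _ => (hS i).le)] at this

end Limits

/-! ### Polyhedra with varying offsets: volume and boundedness -/

section Polyhedra

variable {E : Type*} [NormedAddCommGroup E] [InnerProductSpace ℝ E] {ι : Type*}

/-- The polyhedron cut out by the half-spaces with outward normals `u k` and offsets `h k`. -/
def polyhedron (u : ι → E) (h : ι → ℝ) : Set E := {x | ∀ k, inner ℝ (u k) x ≤ h k}

/-- The face of the polyhedron in direction `u i`. -/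
def polyFace (u : ι → E) (h : ι → ℝ) (i : ι) : Set E :=
  {x | x ∈ polyhedron u h ∧ inner ℝ (u i) x = h i}

lemma isClosed_polyhedron (u : ι → E) (h : ι → ℝ) : IsClosed (polyhedron u h) := by
  rw [polyhedron, Set.ofPred_forall]
  exact isClosed_iInter fun i => isClosed_le (by fun_prop) continuous_const

variable [FiniteDimensional ℝ E] [MeasurableSpace E] [BorelSpace E]

lemma volume_hyperplane {w : E} (hw : w ≠ 0) (β : ℝ) :
    MeasureTheory.volume {x : E | inner ℝ w x = β} = 0 := by
  have h : {x : E | inner ℝ w x = β} =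
      (fun x => x + (-(β / ‖w‖ ^ 2)) • w) ⁻¹' ((ℝ ∙ w)ᗮ : Submodule ℝ E) := by
    ext x
    have : ‖w‖ ≠ 0 := norm_ne_zero_iff.mpr hw
    simp only [Set.mem_preimage, SetLike.mem_coe,
      Submodule.mem_orthogonal_singleton_iff_inner_right, inner_add_right, inner_smul_right,
      real_inner_self_eq_norm_sq]
    rw [neg_mul, div_mul_cancel₀ _ (by positivity), ← sub_eq_add_neg, sub_eq_zero]
    rfl
  rw [h, MeasureTheory.measure_preimage_add_right]
  refine MeasureTheory.Measure.addHaar_submodule _ _ fun htop => hw ?_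
  have : w ∈ (ℝ ∙ w)ᗮ := htop ▸ Submodule.mem_top
  rw [Submodule.mem_orthogonal_singleton_iff_inner_right] at this
  simpa using this

/-- Dominated convergence: off the bounding hyperplanes, which are null, the indicator functions are
eventually constant. A zero normal has no bounding hyperplane, and `h0` keeps its constraint `0 ≤ b
x k` from switching near `x₀`. -/
lemma tendsto_volume_polyhedron [Finite ι] (w : ι → E) {X : Type*} [TopologicalSpace X]
    [FirstCountableTopology X] {b : X → ι → ℝ} {x₀ : X} (hb : ContinuousAt b x₀)
    (h0 : ∀ k, w k = 0 → b x₀ k ≠ 0)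
    (hR : ∃ R, ∀ᶠ x in 𝓝 x₀, polyhedron w (b x) ⊆ Metric.closedBall 0 R) :
    ContinuousAt (fun x => MeasureTheory.volume (polyhedron w (b x))) x₀ := by
  obtain ⟨R, hR⟩ := hR
  refine MeasureTheory.tendsto_measure_of_ae_tendsto_indicator (𝓝 x₀)
    (isClosed_polyhedron _ _).measurableSet (fun x => (isClosed_polyhedron _ _).measurableSet)
    Metric.isClosed_closedBall.measurableSet MeasureTheory.measure_closedBall_lt_top.ne hR ?_
  have hbk : ∀ k, ContinuousAt (fun x => b x k) x₀ := fun k => (continuous_apply k).continuousAt.comp hb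
  have hae : ∀ᵐ y : E, ∀ k, w k ≠ 0 → inner ℝ (w k) y ≠ b x₀ k := by
    rw [MeasureTheory.ae_all_iff]
    intro k
    by_cases hk : w k = 0
    · simp [hk]
    · have := volume_hyperplane hk (b x₀ k)
      rw [← compl_compl {x : E | inner ℝ (w k) x = b x₀ k}] at this
      filter_upwards [MeasureTheory.mem_ae_iff.mpr this] with y hy _
      exact hy
  filter_upwards [hae] with y hy
  have : ∀ᶠ x in 𝓝 x₀, ∀ k, (inner ℝ (w k) y ≤ b x k ↔ inner ℝ (w k) y ≤ b x₀ k) := by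
    rw [Filter.eventually_all]
    intro k
    have hne : inner ℝ (w k) y ≠ b x₀ k := by
      by_cases hk : w k = 0
      · rw [hk, inner_zero_left]; exact (h0 k hk).symm
      · exact hy k hk
    rcases lt_or_gt_of_ne hne with h | h
    · filter_upwards [(hbk k).eventually_const_lt h] with x hx
      exact ⟨fun _ => h.le, fun _ => hx.le⟩
    · filter_upwards [(hbk k).eventually_lt_const h] with x hx
      exact ⟨fun h' => absurd h' (not_le.mpr hx), fun h' => absurd h' (not_le.mpr h)⟩
  filter_upwards [this] with x hx
  exact forall_congr' hx

end Polyhedra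

section Bounded

variable {n : ℕ} {ι : Type*}

/-- The polyhedra with normals `u` are bounded, uniformly for bounded offsets. -/
def UniformlyBounded (u : ι → 𝔼[n]) : Prop :=
  ∀ M : ℝ, ∃ R : ℝ, ∀ h : ι → ℝ, (∀ k, h k ≤ M) → polyhedron u h ⊆ Metric.closedBall 0 R

/-- The positive relation turns upper bounds on all `⟪u k, x⟫` into lower bounds. Spanning makes `x
↦ (⟪u k, x⟫)ₖ` injective, hence antilipschitz. -/
lemma uniformlyBounded_of_sum_eq_zero [Fintype ι] {u : ι → 𝔼[n]} {S : ι → ℝ} (hS : ∀ i, 0 < S i)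
    (hsum : ∑ i, S i • u i = 0) (hspan : Submodule.span ℝ (Set.range u) = ⊤) :
    UniformlyBounded u := by
  intro M
  let f : 𝔼[n] →ₗ[ℝ] (ι → ℝ) := LinearMap.pi fun k => innerₗ _ (u k)
  have hf : ∀ x k, f x k = inner ℝ (u k) x := fun x k => rfl
  have hker : LinearMap.ker f = ⊥ := by
    rw [LinearMap.ker_eq_bot']
    intro x hx
    have h1 : ∀ k, inner ℝ (u k) x = 0 := fun k => by rw [← hf, hx]; rfl
    have h2 : ∀ y ∈ Submodule.span ℝ (Set.range u), inner ℝ y x = 0 := by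
      intro y hy
      induction hy using Submodule.span_induction with
      | mem y hy => obtain ⟨k, rfl⟩ := hy; exact h1 k
      | zero => simp
      | add a b _ _ ha hb => rw [inner_add_left, ha, hb, add_zero]
      | smul c a _ ha => rw [inner_smul_left, ha, mul_zero]
    have := h2 x (hspan ▸ Submodule.mem_top)
    simpa using this
  obtain ⟨K, hK, hanti⟩ := f.exists_antilipschitzWith hker
  set B : ℝ := ∑ k, (|M| + (∑ j, S j * |M|) / S k) with hB
  have hnn : 0 ≤ ∑ j, S j * |M| := Finset.sum_nonneg fun j _ => mul_nonneg (hS j).le (abs_nonneg _)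
  have hterm : ∀ k, 0 ≤ |M| + (∑ j, S j * |M|) / S k := fun k =>
    add_nonneg (abs_nonneg _) (div_nonneg hnn (hS k).le)
  refine ⟨K * B, fun h hh x hx => ?_⟩
  have hle : ∀ k, inner ℝ (u k) x ≤ |M| := fun k => (hx k).trans ((hh k).trans (le_abs_self M))
  have hge : ∀ k, -((∑ j, S j * |M|) / S k) ≤ inner ℝ (u k) x := by
    intro k
    have h0 : ∑ j, S j * inner ℝ (u j) x = 0 := by
      have := congrArg (fun y => inner ℝ y x) hsum
      simpa [sum_inner, inner_smul_left] using this
    have h1 : ∑ j, S j * (|M| - inner ℝ (u j) x) = ∑ j, S j * |M| := by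
      simp only [mul_sub, Finset.sum_sub_distrib, h0, sub_zero]
    have h2 : S k * (|M| - inner ℝ (u k) x) ≤ ∑ j, S j * (|M| - inner ℝ (u j) x) :=
      Finset.single_le_sum (f := fun j => S j * (|M| - inner ℝ (u j) x))
        (fun j _ => mul_nonneg (hS j).le (by linarith [hle j])) (Finset.mem_univ k)
    rw [h1, mul_comm, ← le_div_iff₀ (hS k)] at h2
    linarith [abs_nonneg M]
  rw [mem_closedBall_zero_iff]
  have h1 := hanti.le_mul_dist x 0
  rw [map_zero, dist_zero_right, dist_zero_right] at h1
  refine h1.trans ?_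
  gcongr
  rw [pi_norm_le_iff_of_nonneg (Finset.sum_nonneg fun k _ => hterm k)]
  intro k
  rw [hf, Real.norm_eq_abs]
  refine le_trans ?_ (Finset.single_le_sum (f := fun k => |M| + (∑ j, S j * |M|) / S k)
    (fun j _ => hterm j) (Finset.mem_univ k))
  rw [abs_le]
  have := div_nonneg hnn (hS k).le
  constructor
  · linarith [hge k, abs_nonneg M]
  · linarith [hle k]

end Bounded

/-! ### Faces as polyhedra of one dimension less -/

section FaceArea

variable {n : ℕ} {ι : Type*} {u : ι → 𝔼[n]}

lemma polyFace_eq_image (hu : ∀ i, ‖u i‖ = 1) (h : ι → ℝ) (i : ι) :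
    polyFace u h i = (fun k : (ℝ ∙ u i)ᗮ => (k : 𝔼[n]) + h i • u i) ''
      polyhedron (fun j : {j // j ≠ i} => (ℝ ∙ u i)ᗮ.orthogonalProjectionOnto (u j))
        (fun j => h j - h i * inner ℝ (u j) (u i)) := by
  have hk : ∀ (k : (ℝ ∙ u i)ᗮ), inner ℝ (u i) (k : 𝔼[n]) = 0 := fun k =>
    Submodule.mem_orthogonal_singleton_iff_inner_right.mp k.2
  have hw : ∀ (k : (ℝ ∙ u i)ᗮ) (j : ι), inner ℝ ((ℝ ∙ u i)ᗮ.orthogonalProjectionOnto (u j)) k =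
      inner ℝ (u j) (k : 𝔼[n]) := fun k j =>
    Submodule.inner_orthogonalProjectionOnto_eq_of_mem_right k (u j)
  ext x
  constructor
  · rintro ⟨hx, hxi⟩
    have hxK : x - h i • u i ∈ (ℝ ∙ u i)ᗮ := by
      rw [Submodule.mem_orthogonal_singleton_iff_inner_right, inner_sub_right, hxi,
        inner_smul_right, real_inner_self_eq_norm_sq, hu]
      ring
    refine ⟨⟨_, hxK⟩, fun j => ?_, by simp⟩
    rw [hw]
    simp only [inner_sub_right, inner_smul_right]
    linarith [hx j]
  · rintro ⟨k, hkm, rfl⟩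
    have hxi : inner ℝ (u i) ((k : 𝔼[n]) + h i • u i) = h i := by
      rw [inner_add_right, inner_smul_right, real_inner_self_eq_norm_sq, hu, hk]
      ring
    refine ⟨fun j => ?_, hxi⟩
    by_cases hj : j = i
    · subst hj; exact hxi.le
    · have := hkm ⟨j, hj⟩
      rw [hw] at this
      rw [inner_add_right, inner_smul_right]
      linarith

lemma area_polyFace_eq_volume (hu : ∀ i, ‖u i‖ = 1) (h : ι → ℝ) (i : ι) :
    area (polyFace u h i) = MeasureTheory.volume
      (polyhedron (fun j : {j // j ≠ i} => (ℝ ∙ u i)ᗮ.orthogonalProjectionOnto (u j))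
        (fun j => h j - h i * inner ℝ (u j) (u i))) := by
  have hiso : Isometry (fun k : (ℝ ∙ u i)ᗮ => (k : 𝔼[n]) + h i • u i) :=
    (isometry_add_right (h i • u i)).comp (Submodule.subtypeₗᵢ _).isometry
  have hu0 : u i ≠ 0 := by intro h; simpa [h] using hu i
  rw [polyFace_eq_image hu, area, hiso.euclideanHausdorffMeasure_image,
    ← InnerProductSpace.euclideanHausdorffMeasure_eq_volume,
    finrank_orthogonal_span_singleton_eq hu0]

lemma eq_neg_of_orthogonalProjectionOnto_eq_zero {v w : 𝔼[n]} (hv : ‖v‖ = 1) (hw : ‖w‖ = 1)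
    (hne : w ≠ v) (h : (ℝ ∙ v)ᗮ.orthogonalProjectionOnto w = 0) : w = -v := by
  rw [Submodule.orthogonalProjectionOnto_eq_zero_iff, Submodule.orthogonal_orthogonal,
    Submodule.mem_span_singleton] at h
  obtain ⟨c, rfl⟩ := h
  rw [norm_smul, hv, mul_one, Real.norm_eq_abs] at hw
  rcases (abs_eq zero_le_one).mp hw with rfl | rfl
  · simp at hne
  · simp

variable [Fintype ι]

lemma eventually_polyhedron_subset (hbd : UniformlyBounded u) (h₀ : ι → ℝ) :
    ∃ R, ∀ᶠ h in 𝓝 h₀, polyhedron u h ⊆ Metric.closedBall 0 R := by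
  obtain ⟨R, hR⟩ := hbd (∑ k, |h₀ k| + 1)
  refine ⟨R, ?_⟩
  have : ∀ᶠ h in 𝓝 h₀, ∀ k, h k < ∑ k, |h₀ k| + 1 := by
    rw [Filter.eventually_all]
    intro k
    refine (continuous_apply k).continuousAt.eventually_lt_const ?_
    have := Finset.single_le_sum (f := fun k => |h₀ k|) (fun k _ => abs_nonneg _)
      (Finset.mem_univ k)
    linarith [le_abs_self (h₀ k)]
  filter_upwards [this] with h hh
  exact hR h fun k => (hh k).le

lemma continuousAt_volume_polyhedron (hu : ∀ i, ‖u i‖ = 1) (hbd : UniformlyBounded u)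
    (h₀ : ι → ℝ) : ContinuousAt (fun h => MeasureTheory.volume (polyhedron u h)) h₀ :=
  tendsto_volume_polyhedron u continuousAt_id
    (fun k hk => by have := hu k; rw [hk] at this; simp at this)
    (eventually_polyhedron_subset hbd h₀)

lemma volume_polyhedron_ne_top (hbd : UniformlyBounded u) (h : ι → ℝ) :
    MeasureTheory.volume (polyhedron u h) ≠ ⊤ := by
  obtain ⟨R, hR⟩ := eventually_polyhedron_subset hbd h
  exact ((MeasureTheory.measure_mono hR.self_of_nhds).trans_lt
    MeasureTheory.measure_closedBall_lt_top).ne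

lemma eventually_polyFace_subset (hu : ∀ i, ‖u i‖ = 1) (hbd : UniformlyBounded u)
    (h₀ : ι → ℝ) (i : ι) : ∃ R, ∀ᶠ h in 𝓝 h₀,
      polyhedron (fun j : {j // j ≠ i} => (ℝ ∙ u i)ᗮ.orthogonalProjectionOnto (u j))
        (fun j => h j - h i * inner ℝ (u j) (u i)) ⊆ Metric.closedBall 0 R := by
  obtain ⟨R, hR⟩ := eventually_polyhedron_subset hbd h₀
  refine ⟨R + (|h₀ i| + 1), ?_⟩
  have h2 : ∀ᶠ h in 𝓝 h₀, |h i| < |h₀ i| + 1 :=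
    (continuous_apply i).abs.continuousAt.eventually_lt_const (by simp)
  filter_upwards [hR, h2] with h hh hi k hk
  have h3 : (k : 𝔼[n]) + h i • u i ∈ polyFace u h i := by
    rw [polyFace_eq_image hu]; exact ⟨k, hk, rfl⟩
  have h4 := hh h3.1
  rw [mem_closedBall_zero_iff] at h4 ⊢
  rw [← Submodule.norm_coe]
  have h5 : (k : 𝔼[n]) = ((k : 𝔼[n]) + h i • u i) - h i • u i := by abel
  rw [h5]
  refine (norm_sub_le _ _).trans (add_le_add h4 ?_)
  rw [norm_smul, hu, mul_one, Real.norm_eq_abs]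
  exact hi.le

lemma area_polyFace_ne_top (hu : ∀ i, ‖u i‖ = 1) (hbd : UniformlyBounded u)
    (h : ι → ℝ) (i : ι) : area (polyFace u h i) ≠ ⊤ := by
  obtain ⟨R, hR⟩ := eventually_polyFace_subset hu hbd h i
  rw [area_polyFace_eq_volume hu]
  exact ((MeasureTheory.measure_mono hR.self_of_nhds).trans_lt
    MeasureTheory.measure_closedBall_lt_top).ne

/-- The only normal that projects to zero in the hyperplane of face `i` is `-u i`. Its constraint
becomes `0 ≤ h j + h i`, which is strict for positive offsets. -/
lemma continuousAt_area_polyFace (hu : ∀ i, ‖u i‖ = 1) (hinj : Function.Injective u)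
    (hbd : UniformlyBounded u) {h₀ : ι → ℝ} (h0 : ∀ k, 0 < h₀ k) (i : ι) :
    ContinuousAt (fun h => area (polyFace u h i)) h₀ := by
  simp_rw [area_polyFace_eq_volume hu]
  refine tendsto_volume_polyhedron _ ?_ ?_ (eventually_polyFace_subset hu hbd h₀ i)
  · refine Continuous.continuousAt ?_
    fun_prop
  · rintro ⟨j, hj⟩ hw
    have := eq_neg_of_orthogonalProjectionOnto_eq_zero (hu i) (hu j) (fun h => hj (hinj h)) hw
    simp only [this, inner_neg_left, real_inner_self_eq_norm_sq, hu i]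
    have h1 := h0 i
    have h2 := h0 j
    nlinarith

lemma area_polyFace_pos (hu : ∀ i, ‖u i‖ = 1) {h : ι → ℝ} {i : ι} {x : 𝔼[n]}
    (hxi : inner ℝ (u i) x = h i) (hx : ∀ j ≠ i, inner ℝ (u j) x < h j) :
    0 < area (polyFace u h i) := by
  rw [area_polyFace_eq_volume hu]
  set w := fun j : {j // j ≠ i} => (ℝ ∙ u i)ᗮ.orthogonalProjectionOnto (u j)
  set b := fun j : {j // j ≠ i} => h j - h i * inner ℝ (u j) (u i)
  have hopen : IsOpen {k : (ℝ ∙ u i)ᗮ | ∀ j, inner ℝ (w j) k < b j} := by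
    rw [Set.ofPred_forall]
    exact isOpen_iInter_of_finite fun j => isOpen_lt (by fun_prop) continuous_const
  have hxK : x - h i • u i ∈ (ℝ ∙ u i)ᗮ := by
    rw [Submodule.mem_orthogonal_singleton_iff_inner_right, inner_sub_right, hxi,
      inner_smul_right, real_inner_self_eq_norm_sq, hu]
    ring
  refine (hopen.measure_pos MeasureTheory.volume ⟨⟨_, hxK⟩, fun j => ?_⟩).trans_le
    (MeasureTheory.measure_mono fun k hk j => (hk j).le)
  simp only [w, Submodule.inner_orthogonalProjectionOnto_eq_of_mem_right, b]
  simp only [inner_sub_right, inner_smul_right]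
  linarith [hx j j.2]

end FaceArea

/-- The volume of a polyhedron as integral of slices orthogonal to `u i`. -/
lemma volume_polyhedron_eq_lintegral {n : ℕ} {ι : Type*} {u : ι → 𝔼[n]} [DecidableEq ι] (hu : ∀ i, ‖u i‖ = 1) (h : ι → ℝ) (i : ι) :
    MeasureTheory.volume (polyhedron u h) =
      ∫⁻ s in Set.Iic (h i), area (polyFace u (Function.update h i s) i) := by
  have hu0 : u i ≠ 0 := by intro h; simpa [h] using hu i
  have h1 := EuclideanGeometry.euclideanHausdorffMeasure_eq_lintegral (0 : 𝔼[n]) hu0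
    (isClosed_polyhedron u h).measurableSet
  rw [InnerProductSpace.euclideanHausdorffMeasure_eq_volume, enorm_eq_nnnorm] at h1
  have hun : ‖u i‖₊ = 1 := by ext; simp [hu]
  rw [h1, hun, finrank_euclideanSpace_fin, ENNReal.coe_one, one_mul,
    ← MeasureTheory.lintegral_indicator measurableSet_Iic]
  refine MeasureTheory.lintegral_congr fun s => ?_
  have hmem : ∀ x : 𝔼[n], x ∈ AffineSubspace.mk' (s • u i +ᵥ (0 : 𝔼[n])) (ℝ ∙ u i)ᗮ ↔
      inner ℝ (u i) x = s := by
    intro x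
    rw [AffineSubspace.mem_mk', Submodule.mem_orthogonal_singleton_iff_inner_right]
    simp [inner_sub_right, inner_smul_right, hu, sub_eq_zero]
  by_cases hs : s ≤ h i
  · rw [Set.indicator_of_mem (Set.mem_Iic.mpr hs)]
    unfold area
    congr 1
    ext x
    simp only [Set.mem_inter_iff, SetLike.mem_coe, hmem, polyFace, polyhedron, Set.mem_ofPred_eq,
      Function.update_self]
    constructor
    · rintro ⟨h2, h3⟩
      refine ⟨fun k => ?_, h3⟩
      by_cases hk : k = i
      · subst hk; simp [h3]
      · simpa [hk] using h2 k
    · rintro ⟨h2, h3⟩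
      refine ⟨fun k => ?_, h3⟩
      by_cases hk : k = i
      · subst hk; rw [h3]; exact hs
      · simpa [hk] using h2 k
  · rw [Set.indicator_of_notMem (by simpa using hs)]
    refine (congrArg (fun A : Set 𝔼[n] => μHE[n - 1] A) ?_).trans MeasureTheory.measure_empty
    ext x
    simp only [Set.mem_inter_iff, SetLike.mem_coe, hmem, Set.mem_empty_iff_false, iff_false, not_and]
    intro h2 h3
    exact hs (h3 ▸ h2 i)

/-! ### Face areas as partial derivatives of the volume -/

section Derivative

variable {n : ℕ} {ι : Type*} [Fintype ι] {u : ι → 𝔼[n]}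

/-- Real-valued volume of a polyhedron as function of the offsets. -/
noncomputable def polyVol (u : ι → 𝔼[n]) (h : ι → ℝ) : ℝ :=
  (MeasureTheory.volume (polyhedron u h)).toReal

/-- Real-valued area of a face of a polyhedron as function of the offsets. -/
noncomputable def faceArea (u : ι → 𝔼[n]) (i : ι) (h : ι → ℝ) : ℝ := (area (polyFace u h i)).toReal

lemma continuous_polyVol (hu : ∀ i, ‖u i‖ = 1) (hbd : UniformlyBounded u) :
    Continuous (polyVol u) := by
  rw [continuous_iff_continuousAt]
  exact fun h => (ENNReal.tendsto_toReal (volume_polyhedron_ne_top hbd h)).comp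
    (continuousAt_volume_polyhedron hu hbd h)

lemma continuousAt_faceArea (hu : ∀ i, ‖u i‖ = 1) (hinj : Function.Injective u)
    (hbd : UniformlyBounded u) {h : ι → ℝ} (h0 : ∀ k, 0 < h k) (i : ι) :
    ContinuousAt (faceArea u i) h :=
  (ENNReal.tendsto_toReal (area_polyFace_ne_top hu hbd h i)).comp
    (continuousAt_area_polyFace hu hinj hbd h0 i)

/-- Cavalieri's principle writes the volume as an integral of slice areas; then the fundamental
theorem of calculus applies. -/
lemma hasDerivAt_polyVol_update [DecidableEq ι] (hu : ∀ i, ‖u i‖ = 1) (hinj : Function.Injective u)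
    (hbd : UniformlyBounded u) {h : ι → ℝ} (h0 : ∀ k, 0 < h k) (i : ι) :
    HasDerivAt (fun s => polyVol u (Function.update h i s)) (faceArea u i h) (h i) := by
  set φ : ℝ → ℝ := fun s => faceArea u i (Function.update h i s) with hφ
  have hφc : ∀ s, 0 < s → ContinuousAt φ s := by
    intro s hs
    have hpos : ∀ k, 0 < Function.update h i s k := by
      intro k
      by_cases hk : k = i
      · subst hk; simpa using hs
      · simpa [hk] using h0 k
    have h1 : ContinuousAt (fun s => Function.update h i s) s := by fun_prop
    exact ContinuousAt.comp (g := faceArea u i) (continuousAt_faceArea hu hinj hbd hpos i) h1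
  -- The integral starts at a positive offset, because continuity of the slice areas is available
  -- for positive offsets only.
  set a := h i / 2
  have ha : 0 < a := half_pos (h0 i)
  have hφon : ∀ s, ContinuousOn φ (Set.Icc a s) := fun s x hx =>
    (hφc x (ha.trans_le hx.1)).continuousWithinAt
  have hval : ∀ s, a ≤ s → polyVol u (Function.update h i s) =
      polyVol u (Function.update h i a) + ∫ x in a..s, φ x := by
    intro s hs
    have hV : ∀ s, MeasureTheory.volume (polyhedron u (Function.update h i s)) =
        ∫⁻ x in Set.Iic s, area (polyFace u (Function.update h i x) i) := by
      intro s
      rw [volume_polyhedron_eq_lintegral hu _ i]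
      simp
    have hint : MeasureTheory.IntegrableOn φ (Set.Ioc a s) :=
      ((hφon s).integrableOn_Icc).mono_set Set.Ioc_subset_Icc_self
    have hnn : ∀ x, 0 ≤ φ x := fun x => ENNReal.toReal_nonneg
    have h2 : ∫⁻ x in Set.Ioc a s, area (polyFace u (Function.update h i x) i) =
        ENNReal.ofReal (∫ x in a..s, φ x) := by
      rw [intervalIntegral.integral_of_le hs,
        MeasureTheory.ofReal_integral_eq_lintegral_ofReal hint (Filter.Eventually.of_forall hnn)]
      refine MeasureTheory.lintegral_congr fun x => ?_
      exact (ENNReal.ofReal_toReal (area_polyFace_ne_top hu hbd _ i)).symm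
    have h3 : MeasureTheory.volume (polyhedron u (Function.update h i s)) =
        MeasureTheory.volume (polyhedron u (Function.update h i a)) +
          ENNReal.ofReal (∫ x in a..s, φ x) := by
      rw [hV s, hV a, ← h2, ← MeasureTheory.lintegral_union measurableSet_Ioc
        (Set.Iic_disjoint_Ioc le_rfl), Set.Iic_union_Ioc_eq_Iic hs]
    rw [polyVol, h3, ENNReal.toReal_add (volume_polyhedron_ne_top hbd _) ENNReal.ofReal_ne_top,
      ENNReal.toReal_ofReal (intervalIntegral.integral_nonneg hs fun x _ => hnn x)]
    rfl
  have hai : a < h i := half_lt_self (h0 i)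
  have hder : HasDerivAt (fun s => ∫ x in a..s, φ x) (φ (h i)) (h i) := by
    refine intervalIntegral.integral_hasDerivAt_right ?_ ?_ (hφc _ (h0 i))
    · exact (hφon (h i)).intervalIntegrable_of_Icc hai.le
    · refine ContinuousOn.stronglyMeasurableAtFilter (s := Set.Ioi 0) isOpen_Ioi ?_ _ (h0 i)
      exact fun x hx => (hφc x hx).continuousWithinAt
  have hφi : φ (h i) = faceArea u i h := by simp [hφ]
  rw [hφi] at hder
  refine (hder.const_add (polyVol u (Function.update h i a))).congr_of_eventuallyEq ?_
  filter_upwards [eventually_gt_nhds hai] with s hs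
  exact hval s hs.le

/-- A Lagrange condition in two offsets. Continuous partial derivatives give differentiability in
the pair, and the derivative along the line `(a, -b)` vanishes at the maximum. -/
lemma mul_faceArea_eq_of_isLocalMax [DecidableEq ι] (hu : ∀ i, ‖u i‖ = 1) (hinj : Function.Injective u)
    (hbd : UniformlyBounded u) {h : ι → ℝ} (h0 : ∀ k, 0 < h k) {i j : ι} (hij : i ≠ j)
    {a b : ℝ} (hmax : IsLocalMax (fun t : ℝ => polyVol u
      (Function.update (Function.update h i (h i + t * a)) j (h j - t * b))) 0) :
    a * faceArea u i h = b * faceArea u j h := by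
  set H : ℝ → ℝ → ι → ℝ := fun x y => Function.update (Function.update h i x) j y with hH
  have hHi : ∀ x y, H x y i = x := by intro x y; simp [hH, hij]
  have hHj : ∀ x y, H x y j = y := by intro x y; simp [hH]
  have hH0 : H (h i) (h j) = h := by simp [hH]
  have hHc : Continuous (fun p : ℝ × ℝ => H p.1 p.2) := by simp only [hH]; fun_prop
  have hpos : ∀ᶠ p : ℝ × ℝ in 𝓝 (h i, h j), ∀ k, 0 < H p.1 p.2 k := by
    rw [Filter.eventually_all]
    intro k
    refine ((continuous_apply k).comp hHc).continuousAt.eventually_const_lt ?_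
    simpa [hH0] using h0 k
  have hstrict : HasStrictFDerivAt (Function.HasUncurry.uncurry fun x y => polyVol u (H x y))
      ((ContinuousLinearMap.toSpanSingleton ℝ (faceArea u i h)).coprod
        (ContinuousLinearMap.toSpanSingleton ℝ (faceArea u j h))) (h i, h j) := by
    have := hasStrictFDerivAt_uncurry_coprod (𝕜 := ℝ) (u := (h i, h j))
      (f := fun x y => polyVol u (H x y))
      (f₁ := fun x y => ContinuousLinearMap.toSpanSingleton ℝ (faceArea u i (H x y)))
      (f₂ := fun x y => ContinuousLinearMap.toSpanSingleton ℝ (faceArea u j (H x y)))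
      ?_ ?_ ?_ ?_
    · simpa [Function.HasUncurry.uncurry, hH0] using this
    · filter_upwards [hpos] with p hp
      have := hasDerivAt_polyVol_update hu hinj hbd hp i
      rw [hHi] at this
      have h1 : ∀ s, Function.update (H p.1 p.2) i s = H s p.2 := by
        intro s
        simp only [hH]
        rw [Function.update_comm hij, Function.update_idem, Function.update_comm hij.symm]
      simp_rw [h1] at this
      exact this.hasFDerivAt
    · filter_upwards [hpos] with p hp
      have := hasDerivAt_polyVol_update hu hinj hbd hp j
      rw [hHj] at this
      have h1 : ∀ s, Function.update (H p.1 p.2) j s = H p.1 s := by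
        intro s
        simp only [hH, Function.update_idem]
      simp_rw [h1] at this
      exact this.hasFDerivAt
    all_goals
      have h1 : ∀ k, ContinuousAt (fun p : ℝ × ℝ => faceArea u k (H p.1 p.2)) (h i, h j) := by
        intro k
        refine ContinuousAt.comp (g := faceArea u k) ?_ hHc.continuousAt
        simp only [hH0]
        exact continuousAt_faceArea hu hinj hbd h0 k
      have h2 : Continuous (fun r : ℝ => ContinuousLinearMap.toSpanSingleton ℝ r) :=
        (ContinuousLinearMap.toSpanSingletonCLE (𝕜 := ℝ) (E := ℝ)).continuous
      exact h2.continuousAt.comp (h1 _)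
  have hline : HasDerivAt (fun t : ℝ => (h i + t * a, h j - t * b)) (a, -b) 0 := by
    refine HasDerivAt.prodMk ?_ ?_
    · simpa using ((hasDerivAt_id (0 : ℝ)).mul_const a).const_add (h i)
    · simpa using ((hasDerivAt_id (0 : ℝ)).mul_const b).const_sub (h j)
  have hcomp := HasFDerivAt.comp_hasDerivAt_of_eq (x := (0 : ℝ)) hstrict.hasFDerivAt hline (by simp)
  have := hmax.hasDerivAt_eq_zero hcomp
  simp at this
  linarith

end Derivative

/-! ### Flat points of polyhedra -/

section FlatPoints

variable {n : ℕ} {ι : Type*} [Finite ι] {u : ι → 𝔼[n]} {h : ι → ℝ}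

lemma isNormalAt_polyhedron {i : ι} {y : 𝔼[n]} (hi : inner ℝ (u i) y = h i)
    (hj : ∀ j ≠ i, inner ℝ (u j) y < h j) : IsNormalAt (polyhedron u h) (u i) y := by
  have : ∀ᶠ z in 𝓝 y, ∀ j, j ≠ i → inner ℝ (u j) z < h j := by
    rw [Filter.eventually_all]
    intro j
    by_cases h' : j = i
    · exact Filter.Eventually.of_forall fun z hz => absurd h' hz
    · have hc : ContinuousAt (fun z : 𝔼[n] => inner ℝ (u j) z) y := by fun_prop
      exact (hc.eventually_lt_const (hj j h')).mono fun z hz _ => hz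
  filter_upwards [this] with z hz
  rw [inner_sub_right, hi, sub_nonpos]
  refine ⟨fun h' => h' i, fun h' j => ?_⟩
  by_cases hji : j = i
  · subst hji; exact h'
  · exact (hz j hji).le

/-- All constraints tight at a flat point share its unit normal, so injectivity of `u` leaves just
one. -/
lemma mem_flatPoints_polyhedron_iff (hu : ∀ i, ‖u i‖ = 1) (hinj : Function.Injective u)
    {y : 𝔼[n]} : y ∈ flatPoints (polyhedron u h) ↔
      ∃ i, inner ℝ (u i) y = h i ∧ ∀ j ≠ i, inner ℝ (u j) y < h j := by
  constructor
  · intro hy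
    obtain ⟨v, hv1, hv⟩ := exists_unit_normal_of_mem_flatPoints hy
    have hyP := hv.mem
    have hv0 : v ≠ 0 := by rintro rfl; simp at hv1
    have htight : ∀ i, inner ℝ (u i) y = h i → u i = v := by
      intro i hi
      obtain ⟨c, hc, hcv⟩ := exists_nonneg_smul_of_halfSpace_le (u := u i) hv0
        (halfSpace_le_of_eventually (y := y) (by
          filter_upwards [hv] with z hz hz'
          rw [inner_sub_right, hi, sub_nonpos]
          exact hz.2 hz' i))
      have := hu i
      rw [hcv, norm_smul, hv1, mul_one, Real.norm_of_nonneg hc] at this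
      rw [hcv, this, one_smul]
    have hex : ∃ i, inner ℝ (u i) y = h i := by
      by_contra! hcon
      refine frequently_notMem_of_mem_flatPoints hy ?_
      have : ∀ᶠ z in 𝓝 y, ∀ j, inner ℝ (u j) z < h j := by
        rw [Filter.eventually_all]
        intro j
        have hc : ContinuousAt (fun z : 𝔼[n] => inner ℝ (u j) z) y := by fun_prop
        exact hc.eventually_lt_const (lt_of_le_of_ne (hyP j) (hcon j))
      filter_upwards [this] with z hz
      simp only [not_not]
      exact fun j => (hz j).le
    obtain ⟨i, hi⟩ := hex
    refine ⟨i, hi, fun j hj => lt_of_le_of_ne (hyP j) fun h' => hj (hinj ?_)⟩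
    rw [htight i hi, htight j h']
  · rintro ⟨i, hi, hj⟩
    exact ⟨u i, by intro h0; simpa [h0] using hu i, isNormalAt_polyhedron hi hj⟩

end FlatPoints

/-! ### Minkowski's existence theorem -/

section Minkowski

variable {n m : ℕ} {u : Fin m → 𝔼[n]} {h : Fin m → ℝ}

lemma isConvexPolytope_polyhedron (hbd : UniformlyBounded u) (h0 : ∀ k, 0 < h k) :
    IsConvexPolytope (polyhedron u h) := by
  refine ⟨⟨m, u, h, rfl⟩, ?_, 0, ?_⟩
  · obtain ⟨R, hR⟩ := eventually_polyhedron_subset hbd h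
    exact Metric.isBounded_closedBall.subset hR.self_of_nhds
  · have hopen : IsOpen {x : 𝔼[n] | ∀ k, inner ℝ (u k) x < h k} := by
      rw [Set.ofPred_forall]
      exact isOpen_iInter_of_finite fun j => isOpen_lt (by fun_prop) continuous_const
    exact interior_maximal (fun x hx k => (hx k).le) hopen (by simpa using h0)

/-- Some face of a polyhedron with interior points is a facet. -/
lemma exists_polyFace_area_pos (hn : 1 ≤ n) (hu : ∀ i, ‖u i‖ = 1) (hinj : Function.Injective u)
    (hbd : UniformlyBounded u) (h0 : ∀ k, 0 < h k) : ∃ i, 0 < area (polyFace u h i) := by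
  have hP := isConvexPolytope_polyhedron hbd h0
  obtain ⟨v, hv⟩ : ∃ v : 𝔼[n], v ≠ 0 := by
    refine Module.finrank_pos_iff_exists_ne_zero (R := ℝ).mp ?_
    rw [finrank_euclideanSpace_fin]; omega
  obtain ⟨D, hD, hexit⟩ := hP.isPolytope.exists_dense_exit hv
  obtain ⟨p, hp, hpD⟩ := hD.inter_open_nonempty _ isOpen_interior hP.2.2
  obtain ⟨t, -, w, hw, hnorm⟩ := hexit p hpD (interior_subset hp)
  have hflat : p + t • v ∈ flatPoints (polyhedron u h) := ⟨w, by rintro rfl; simp at hw, hnorm⟩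
  obtain ⟨i, hi, hj⟩ := (mem_flatPoints_polyhedron_iff hu hinj).mp hflat
  exact ⟨i, area_polyFace_pos hu hi hj⟩

/-- A maximizer on the compact simplex may have zero offsets, but it has positive volume and thus a
point `x₀` on no bounding hyperplane. Moving `x₀` to the origin makes all offsets positive. It
preserves the volume, and also `∑ S i * h i` because `∑ S i • u i = 0`. -/
lemma exists_isMaxOn_polyVol (hu : ∀ i, ‖u i‖ = 1) (hbd : UniformlyBounded u) {S : Fin m → ℝ}
    (hS : ∀ i, 0 < S i) (hm : 0 < m) (hsum : ∑ i, S i • u i = 0) :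
    ∃ h : Fin m → ℝ, (∀ i, 0 < h i) ∧ ∑ i, S i * h i = 1 ∧
      ∀ g : Fin m → ℝ, (∀ i, 0 ≤ g i) → ∑ i, S i * g i = 1 → polyVol u g ≤ polyVol u h := by
  set Δ : Set (Fin m → ℝ) := {g | (∀ i, 0 ≤ g i) ∧ ∑ i, S i * g i = 1} with hΔ
  have hΔc : IsCompact Δ := by
    refine (isCompact_Icc (a := (0 : Fin m → ℝ)) (b := fun i => 1 / S i)).of_isClosed_subset ?_ ?_
    · refine IsClosed.inter ?_ (isClosed_eq (by fun_prop) continuous_const)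
      have : {g : Fin m → ℝ | ∀ i, 0 ≤ g i} = Set.Ici 0 := by ext g; simp [Pi.le_def]
      have h2 : IsClosed {g : Fin m → ℝ | ∀ i, 0 ≤ g i} := by rw [this]; exact isClosed_Ici
      exact h2
    · rintro g ⟨hg0, hg1⟩
      refine ⟨hg0, fun i => ?_⟩
      simp only
      rw [le_div_iff₀ (hS i), ← hg1, mul_comm]
      exact Finset.single_le_sum (f := fun i => S i * g i)
        (fun j _ => mul_nonneg (hS j).le (hg0 j)) (Finset.mem_univ i)
  have : Nonempty (Fin m) := ⟨⟨0, hm⟩⟩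
  have hSpos : 0 < ∑ i, S i := Finset.sum_pos (fun i _ => hS i) Finset.univ_nonempty
  set g₀ : Fin m → ℝ := fun _ => 1 / ∑ i, S i with hg₀
  have hg₀pos : ∀ i, 0 < g₀ i := fun i => by simp only [hg₀]; positivity
  have hg₀Δ : g₀ ∈ Δ := by
    refine ⟨fun i => (hg₀pos i).le, ?_⟩
    simp only [hg₀]
    rw [← Finset.sum_mul]
    field_simp
  obtain ⟨h₁, hh₁, hmax⟩ := hΔc.exists_isMaxOn ⟨g₀, hg₀Δ⟩ (continuous_polyVol hu hbd).continuousOn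
  have hvol : MeasureTheory.volume (polyhedron u h₁) ≠ 0 := by
    intro h0
    have h1 : polyVol u g₀ ≤ polyVol u h₁ := hmax hg₀Δ
    have h2 : 0 < polyVol u g₀ := by
      refine ENNReal.toReal_pos ?_ (volume_polyhedron_ne_top hbd _)
      have h3 := (isConvexPolytope_polyhedron hbd hg₀pos).2.2
      exact ((isOpen_interior.measure_pos MeasureTheory.volume h3).trans_le
        (MeasureTheory.measure_mono interior_subset)).ne'
    rw [show polyVol u h₁ = 0 by simp [polyVol, h0]] at h1
    linarith
  obtain ⟨x₀, hx₀, hx₀s⟩ : ∃ x ∈ polyhedron u h₁, ∀ k, inner ℝ (u k) x ≠ h₁ k := by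
    by_contra! hcon
    refine hvol (MeasureTheory.measure_mono_null (t := ⋃ k, {x : 𝔼[n] | inner ℝ (u k) x = h₁ k})
      (fun x hx => Set.mem_iUnion.mpr (hcon x hx)) ?_)
    rw [MeasureTheory.measure_iUnion_null_iff]
    exact fun k => volume_hyperplane (by intro h; simpa [h] using hu k) _
  set h : Fin m → ℝ := fun k => h₁ k - inner ℝ (u k) x₀ with hh
  have htrans : polyVol u h = polyVol u h₁ := by
    have : polyhedron u h = (fun x => x + x₀) ⁻¹' polyhedron u h₁ := by
      ext x
      simp only [polyhedron, Set.mem_preimage, Set.mem_ofPred_eq, inner_add_right, hh,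
        le_sub_iff_add_le]
    rw [polyVol, this, MeasureTheory.measure_preimage_add_right]
    rfl
  refine ⟨h, fun k => sub_pos.mpr (lt_of_le_of_ne (hx₀ k) (hx₀s k)), ?_, fun g hg0 hg1 => ?_⟩
  · have h0 : ∑ j, S j * inner ℝ (u j) x₀ = 0 := by
      have := congrArg (fun y => inner ℝ y x₀) hsum
      simpa [sum_inner, inner_smul_left] using this
    simp only [hh, mul_sub, Finset.sum_sub_distrib, h0, sub_zero, hh₁.2]
  · rw [htrans]
    exact hmax ⟨hg0, hg1⟩

open scoped Pointwise in
lemma polyFace_smul (u : Fin m → 𝔼[n]) (h : Fin m → ℝ) {r : ℝ} (hr : 0 < r) (i : Fin m) :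
    polyFace u (r • h) i = r • polyFace u h i := by
  ext x
  rw [Set.mem_smul_set_iff_inv_smul_mem₀ hr.ne']
  simp only [polyFace, polyhedron, Set.mem_ofPred_eq, inner_smul_right, Pi.smul_apply, smul_eq_mul,
    inv_mul_le_iff₀ hr, inv_mul_eq_iff_eq_mul₀ hr.ne']

/-- **Minkowski's existence theorem** for polytopes. -/
theorem exists_polyhedron_area_polyFace_eq (hn : 2 ≤ n) (hu : ∀ i, ‖u i‖ = 1)
    (hinj : Function.Injective u) (hspan : Submodule.span ℝ (Set.range u) = ⊤) {S : Fin m → ℝ}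
    (hS : ∀ i, 0 < S i) (hsum : ∑ i, S i • u i = 0) :
    ∃ h : Fin m → ℝ, (∀ i, 0 < h i) ∧ ∀ i, area (polyFace u h i) = ENNReal.ofReal (S i) := by
  have hbd := uniformlyBounded_of_sum_eq_zero hS hsum hspan
  have hm : 0 < m := by
    rcases Nat.eq_zero_or_pos m with rfl | h
    · have h1 : Set.range u = ∅ := Set.range_eq_empty u
      rw [h1, Submodule.span_empty] at hspan
      have h2 : Module.finrank ℝ (⊥ : Submodule ℝ 𝔼[n]) = Module.finrank ℝ 𝔼[n] := by
        rw [hspan, finrank_top]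
      rw [finrank_bot, finrank_euclideanSpace_fin] at h2
      omega
    · exact h
  obtain ⟨h, h0, h1, hmax⟩ := exists_isMaxOn_polyVol hu hbd hS hm hsum
  -- Changing `h i` by `t / S i` and `h j` by `-t / S j` stays on the constraint `∑ S i * h i = 1`.
  have hprop : ∀ i j, i ≠ j → (S i)⁻¹ * faceArea u i h = (S j)⁻¹ * faceArea u j h := by
    intro i j hij
    refine mul_faceArea_eq_of_isLocalMax hu hinj hbd h0 hij ?_
    have hH : Continuous (fun t : ℝ => Function.update
        (Function.update h i (h i + t * (S i)⁻¹)) j (h j - t * (S j)⁻¹)) := by fun_prop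
    have hpos : ∀ᶠ t : ℝ in 𝓝 0, ∀ k, 0 < Function.update
        (Function.update h i (h i + t * (S i)⁻¹)) j (h j - t * (S j)⁻¹) k := by
      rw [Filter.eventually_all]
      intro k
      refine ((continuous_apply k).comp hH).continuousAt.eventually_const_lt ?_
      simpa using h0 k
    filter_upwards [hpos] with t ht
    simp only [zero_mul, add_zero, sub_zero, Function.update_eq_self]
    refine hmax _ (fun k => (ht k).le) ?_
    have hexp : Function.update (Function.update h i (h i + t * (S i)⁻¹)) j (h j - t * (S j)⁻¹) =
        fun k => h k + (if k = i then t * (S i)⁻¹ else 0) - (if k = j then t * (S j)⁻¹ else 0) := by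
      ext k
      by_cases hkj : k = j
      · subst hkj; simp [hij.symm]
      · by_cases hki : k = i
        · subst hki; simp [hij]
        · simp [hkj, hki]
    rw [hexp]
    simp only [mul_sub, mul_add, Finset.sum_sub_distrib, Finset.sum_add_distrib, h1, mul_ite,
      mul_zero, Finset.sum_ite_eq', Finset.mem_univ, if_true]
    have := (hS i).ne'
    have := (hS j).ne'
    field_simp
    ring
  obtain ⟨i₀, hi₀⟩ := exists_polyFace_area_pos (by omega) hu hinj hbd h0
  have hA₀ : 0 < faceArea u i₀ h := ENNReal.toReal_pos hi₀.ne' (area_polyFace_ne_top hu hbd h i₀)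
  set c := (S i₀)⁻¹ * faceArea u i₀ h with hc
  have hcpos : 0 < c := mul_pos (inv_pos.mpr (hS i₀)) hA₀
  have hA : ∀ i, faceArea u i h = c * S i := by
    intro i
    have h2 : (S i)⁻¹ * faceArea u i h = c := by
      by_cases h' : i = i₀
      · rw [h']
      · exact hprop i i₀ h'
    rw [← h2]
    have := (hS i).ne'
    field_simp
  have hn1 : ((n - 1 : ℕ) : ℝ) ≠ 0 := by
    have : n - 1 ≠ 0 := by omega
    exact_mod_cast this
  -- Dilation by `r` multiplies areas by `r ^ (n - 1)`, which has to cancel the factor `c`.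
  set r : ℝ := c⁻¹ ^ (((n - 1 : ℕ) : ℝ)⁻¹) with hr
  have hrpos : 0 < r := Real.rpow_pos_of_pos (inv_pos.mpr hcpos) _
  have hrpow : r ^ (n - 1) = c⁻¹ := by
    rw [hr, ← Real.rpow_natCast, ← Real.rpow_mul (inv_pos.mpr hcpos).le, inv_mul_cancel₀ hn1,
      Real.rpow_one]
  refine ⟨r • h, fun i => mul_pos hrpos (h0 i), fun i => ?_⟩
  have h2 : area (polyFace u h i) = ENNReal.ofReal (c * S i) := by
    rw [← hA, faceArea, ENNReal.ofReal_toReal (area_polyFace_ne_top hu hbd h i)]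
  have h3 : area (polyFace u (r • h) i) = ENNReal.ofReal (r ^ (n - 1)) * area (polyFace u h i) := by
    rw [polyFace_smul u h hrpos, area, MeasureTheory.Measure.euclideanHausdorffMeasure_smul₀ _
      hrpos.ne', ENNReal.ofReal_pow hrpos.le, ← Real.enorm_of_nonneg hrpos.le]
    rfl
  rw [h3, h2, ← ENNReal.ofReal_mul (by positivity), hrpow, inv_mul_cancel_left₀ hcpos.ne']

end Minkowski

/-! ### Identifying the facets of a polyhedron -/

section FacetsOfPolyhedra

variable {n : ℕ} {ι : Type*} {u : ι → 𝔼[n]} {h : ι → ℝ}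

/-- The relative interior of a face. -/
def polyFaceInterior (u : ι → 𝔼[n]) (h : ι → ℝ) (i : ι) : Set 𝔼[n] :=
  {x | inner ℝ (u i) x = h i ∧ ∀ j ≠ i, inner ℝ (u j) x < h j}

lemma convex_polyFaceInterior (i : ι) : Convex ℝ (polyFaceInterior u h i) := by
  intro x hx y hy a b ha hb hab
  refine ⟨?_, fun j hj => ?_⟩
  · rw [inner_add_right, inner_smul_right, inner_smul_right, hx.1, hy.1, ← add_mul, hab, one_mul]
  · rw [inner_add_right, inner_smul_right, inner_smul_right]
    have h1 := hx.2 j hj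
    have h2 := hy.2 j hj
    have h3 : h j = a * h j + b * h j := by rw [← add_mul, hab, one_mul]
    rw [h3]
    rcases ha.eq_or_lt with rfl | ha'
    · rw [zero_add] at hab; subst hab; linarith
    · have := mul_lt_mul_of_pos_left h1 ha'
      have := mul_le_mul_of_nonneg_left h2.le hb
      linarith

/-- The flat points are separated by two open sets: all constraints other than `i` strict, or
constraint `i` strict. No flat point lies in both, since one constraint is tight. -/
lemma connectedComponentIn_flatPoints_polyhedron [Finite ι] (hu : ∀ i, ‖u i‖ = 1)
    (hinj : Function.Injective u) {i : ι} {x : 𝔼[n]} (hx : x ∈ polyFaceInterior u h i) :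
    connectedComponentIn (flatPoints (polyhedron u h)) x = polyFaceInterior u h i := by
  have hsub : polyFaceInterior u h i ⊆ flatPoints (polyhedron u h) := fun y hy =>
    (mem_flatPoints_polyhedron_iff hu hinj).mpr ⟨i, hy.1, hy.2⟩
  refine Set.Subset.antisymm ?_
    ((convex_polyFaceInterior i).isPreconnected.subset_connectedComponentIn hx hsub)
  set C := connectedComponentIn (flatPoints (polyhedron u h)) x
  have hC : C ⊆ flatPoints (polyhedron u h) := connectedComponentIn_subset _ _
  have hxC : x ∈ C := mem_connectedComponentIn (hsub hx)
  have hU : IsOpen {y : 𝔼[n] | ∀ j, j ≠ i → inner ℝ (u j) y < h j} := by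
    rw [Set.ofPred_forall]
    refine isOpen_iInter_of_finite fun j => ?_
    by_cases hj : j = i
    · simp [hj]
    · simp only [ne_eq, hj, not_false_eq_true, forall_const]
      exact isOpen_lt (by fun_prop) continuous_const
  have hV : IsOpen {y : 𝔼[n] | inner ℝ (u i) y < h i} := isOpen_lt (by fun_prop) continuous_const
  have hcov : ∀ y ∈ C, y ∈ polyFaceInterior u h i ∨ inner ℝ (u i) y < h i := by
    intro y hy
    obtain ⟨j, hj, hk⟩ := (mem_flatPoints_polyhedron_iff hu hinj).mp (hC hy)
    by_cases hji : j = i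
    · subst hji; exact Or.inl ⟨hj, hk⟩
    · exact Or.inr (hk i (Ne.symm hji))
  intro y hy
  rcases hcov y hy with h' | h'
  · exact h'
  · exfalso
    obtain ⟨z, hzC, hzU, hzV⟩ := isPreconnected_connectedComponentIn _ _ hU hV
      (fun y hy => (hcov y hy).imp (fun h => h.2) id) ⟨x, hxC, hx.2⟩ ⟨y, hy, h'⟩
    obtain ⟨j, hj, hk⟩ := (mem_flatPoints_polyhedron_iff hu hinj).mp (hC hzC)
    by_cases hji : j = i
    · subst hji; exact absurd hj (ne_of_lt hzV)
    · exact absurd hj (ne_of_lt (hzU j hji))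

lemma closure_polyFaceInterior {i : ι} (hne : (polyFaceInterior u h i).Nonempty) :
    closure (polyFaceInterior u h i) = polyFace u h i := by
  obtain ⟨z, hz⟩ := hne
  refine Set.Subset.antisymm (closure_minimal ?_ ?_) ?_
  · intro x hx
    refine ⟨fun j => ?_, hx.1⟩
    by_cases hj : j = i
    · subst hj; exact hx.1.le
    · exact (hx.2 j hj).le
  · exact (isClosed_polyhedron u h).inter (isClosed_eq (by fun_prop) continuous_const)
  · rintro x ⟨hx, hxi⟩
    have hcont : Filter.Tendsto (fun t : ℝ => x + t • (z - x)) (𝓝[>] 0) (𝓝 x) := by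
      have : Continuous (fun t : ℝ => x + t • (z - x)) := by fun_prop
      simpa using (this.tendsto 0).mono_left nhdsWithin_le_nhds
    refine mem_closure_of_tendsto hcont ?_
    filter_upwards [Ioc_mem_nhdsGT (zero_lt_one' ℝ)] with t ht
    refine ⟨?_, fun j hj => ?_⟩
    · rw [inner_add_right, inner_smul_right, inner_sub_right, hz.1, hxi]
      ring
    · rw [inner_add_right, inner_smul_right, inner_sub_right]
      have h1 := hx j
      have h2 := hz.2 j hj
      nlinarith [ht.1, ht.2, mul_pos ht.1 (sub_pos.mpr h2),
        mul_nonneg (sub_nonneg.mpr ht.2) (sub_nonneg.mpr h1)]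

/-- Otherwise the face would lie in finitely many hyperplanes of its own hyperplane and be null. A
normal opposite to `u i` cuts out no such hyperplane, but positive offsets keep it from being tight.
-/
lemma polyFaceInterior_nonempty [Finite ι] (hu : ∀ i, ‖u i‖ = 1) (hinj : Function.Injective u)
    (h0 : ∀ k, 0 < h k) {i : ι} (hpos : 0 < area (polyFace u h i)) :
    (polyFaceInterior u h i).Nonempty := by
  rw [area_polyFace_eq_volume hu] at hpos
  by_contra hcon
  rw [Set.not_nonempty_iff_eq_empty] at hcon
  refine hpos.ne' (MeasureTheory.measure_mono_null (t := ⋃ j : {j : {j // j ≠ i} //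
    (ℝ ∙ u i)ᗮ.orthogonalProjectionOnto (u j) ≠ 0}, {k : (ℝ ∙ u i)ᗮ |
      inner ℝ ((ℝ ∙ u i)ᗮ.orthogonalProjectionOnto (u j)) k =
        h j - h i * inner ℝ (u j) (u i)}) ?_ ?_)
  · intro k hk
    by_contra hk'
    simp only [Set.mem_iUnion, not_exists, Set.mem_ofPred_eq] at hk'
    have hmem : (k : 𝔼[n]) + h i • u i ∈ polyFace u h i := by
      rw [polyFace_eq_image hu]; exact ⟨k, hk, rfl⟩
    have : (k : 𝔼[n]) + h i • u i ∈ polyFaceInterior u h i := by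
      refine ⟨hmem.2, fun j hj => ?_⟩
      by_cases hw : (ℝ ∙ u i)ᗮ.orthogonalProjectionOnto (u j) = 0
      · rw [eq_neg_of_orthogonalProjectionOnto_eq_zero (hu i) (hu j) (fun h => hj (hinj h)) hw,
          inner_neg_left, hmem.2]
        linarith [h0 i, h0 j]
      · have h1 := lt_of_le_of_ne (hk ⟨j, hj⟩) (hk' ⟨⟨j, hj⟩, hw⟩)
        rw [Submodule.inner_orthogonalProjectionOnto_eq_of_mem_right] at h1
        rw [inner_add_right, inner_smul_right]
        linarith
    rw [hcon] at this
    exact this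
  · rw [MeasureTheory.measure_iUnion_null_iff]
    exact fun j => volume_hyperplane j.2 _

end FacetsOfPolyhedra

lemma listsFacets_polyhedron {n m : ℕ} {u : Fin m → 𝔼[n]} {h : Fin m → ℝ} (hu : ∀ i, ‖u i‖ = 1)
    (hinj : Function.Injective u) (h0 : ∀ k, 0 < h k)
    (hpos : ∀ i, 0 < area (polyFace u h i)) : ListsFacets (polyhedron u h) (polyFace u h) := by
  have hne := fun i => polyFaceInterior_nonempty hu hinj h0 (hpos i)
  constructor
  · intro i j hij
    by_contra hne'
    obtain ⟨z, hz⟩ := hne i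
    have h1 : z ∈ polyFace u h j := by
      rw [← hij, ← closure_polyFaceInterior (hne i)]
      exact subset_closure hz
    exact absurd h1.2 (ne_of_lt (hz.2 j (Ne.symm hne')))
  · ext G
    constructor
    · rintro ⟨i, rfl⟩
      obtain ⟨z, hz⟩ := hne i
      refine ⟨z, (mem_flatPoints_polyhedron_iff hu hinj).mpr ⟨i, hz.1, hz.2⟩, ?_⟩
      rw [connectedComponentIn_flatPoints_polyhedron hu hinj hz, closure_polyFaceInterior ⟨z, hz⟩]
    · rintro ⟨x, hx, rfl⟩
      obtain ⟨i, hi⟩ := (mem_flatPoints_polyhedron_iff hu hinj).mp hx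
      refine ⟨i, ?_⟩
      rw [connectedComponentIn_flatPoints_polyhedron hu hinj (i := i) hi,
        closure_polyFaceInterior ⟨x, hi⟩]

/-- Vectors that are positively dependent and span the space are the facet normals of a convex
polytope with prescribed facet areas. -/
theorem exists_convexPolytope_of_normals {n m : ℕ} (hn : 2 ≤ n) {u : Fin m → 𝔼[n]}
    (hu : ∀ i, ‖u i‖ = 1) (hinj : Function.Injective u)
    (hspan : Submodule.span ℝ (Set.range u) = ⊤) {S : Fin m → ℝ} (hS : ∀ i, 0 < S i)
    (hsum : ∑ i, S i • u i = 0) :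
    ∃ (P : Set 𝔼[n]) (F : Fin m → Set 𝔼[n]),
      IsConvexPolytope P ∧ ListsFacets P F ∧ ∀ i, area (F i) = ENNReal.ofReal (S i) := by
  obtain ⟨h, h0, hA⟩ := exists_polyhedron_area_polyFace_eq hn hu hinj hspan hS hsum
  exact ⟨polyhedron u h, polyFace u h,
    isConvexPolytope_polyhedron (uniformlyBounded_of_sum_eq_zero hS hsum hspan) h0,
    listsFacets_polyhedron hu hinj h0 fun i => by rw [hA]; exact ENNReal.ofReal_pos.mpr (hS i), hA⟩

/-! ### Closed plane polygons with given side lengths -/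

lemma exists_triangle {A B C : ℝ} (hA : 0 < A) (hB : 0 < B) (hC : 0 < C) (h1 : A < B + C)
    (h2 : B < A + C) (h3 : C < A + B) : ∃ p q : ℝ, 0 < q ∧ p ^ 2 + q ^ 2 = B ^ 2 ∧
      (A - p) ^ 2 + q ^ 2 = C ^ 2 := by
  set p := (A ^ 2 + B ^ 2 - C ^ 2) / (2 * A) with hp
  have hpA : 2 * A * p = A ^ 2 + B ^ 2 - C ^ 2 := by rw [hp]; field_simp
  have hpos : 0 < B ^ 2 - p ^ 2 := by
    have h4 : 0 < (2 * A) ^ 2 * (B ^ 2 - p ^ 2) := by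
      -- Heron's factorization: each factor is positive by a triangle inequality.
      have h5 : (2 * A) ^ 2 * (B ^ 2 - p ^ 2) =
          ((A + B + C) * (A + B - C)) * ((C + A - B) * (C - A + B)) := by
        rw [mul_sub, ← mul_pow, ← mul_pow, hpA]; ring
      rw [h5]
      have : 0 < A + B - C := by linarith
      have : 0 < C + A - B := by linarith
      have : 0 < C - A + B := by linarith
      positivity
    exact pos_of_mul_pos_right h4 (by positivity)
  refine ⟨p, √(B ^ 2 - p ^ 2), Real.sqrt_pos.mpr hpos, ?_, ?_⟩
  · rw [Real.sq_sqrt hpos.le]; ring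
  · rw [Real.sq_sqrt hpos.le]; linarith [hpA, sub_sq A p]

/-- Closed plane polygons with prescribed side lengths that are not contained in a line. -/
lemma exists_plane_polygon {ι : Type*} [DecidableEq ι] (s : Finset ι) (hs : 3 ≤ s.card)
    (S : ι → ℝ) (hS : ∀ i ∈ s, 0 < S i) (hpoly : ∀ i ∈ s, 2 * S i < ∑ j ∈ s, S j) :
    ∃ x y : ι → ℝ, (∀ i ∈ s, x i ^ 2 + y i ^ 2 = 1) ∧ ∑ i ∈ s, S i * x i = 0 ∧
      ∑ i ∈ s, S i * y i = 0 ∧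
      ∀ α β : ℝ, (∀ i ∈ s, x i * α + y i * β = 0) → α = 0 ∧ β = 0 := by
  induction hk : s.card - 3 generalizing s S with
  | zero =>
    obtain ⟨a, b, c, hab, hac, hbc, rfl⟩ := Finset.card_eq_three.mp (by omega : s.card = 3)
    have hsum : ∀ f : ι → ℝ, ∑ i ∈ ({a, b, c} : Finset ι), f i = f a + (f b + f c) := by
      intro f
      rw [Finset.sum_insert (by simp [hab, hac]), Finset.sum_pair hbc]
    simp only [hsum, Finset.mem_insert, Finset.mem_singleton, forall_eq_or_imp, forall_eq] at *
    obtain ⟨hA, hB, hC⟩ := hS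
    obtain ⟨h1, h2, h3⟩ := hpoly
    obtain ⟨p, q, hq, hpq, hpq'⟩ := exists_triangle hA hB hC (by linarith) (by linarith)
      (by linarith)
    refine ⟨fun i => if i = a then -1 else if i = b then p / S b else (S a - p) / S c,
      fun i => if i = a then 0 else if i = b then q / S b else -q / S c, ?_, ?_, ?_, ?_⟩
    · simp only [if_true, hab.symm, hac.symm, hbc.symm, if_false]
      refine ⟨by norm_num, ?_, ?_⟩
      · rw [div_pow, div_pow, ← add_div, hpq, div_self (by positivity)]
      · rw [div_pow, div_pow, ← add_div, neg_sq, hpq', div_self (by positivity)]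
    · simp only [if_true, hab.symm, hac.symm, hbc.symm, if_false]
      field_simp
      ring
    · simp only [if_true, hab.symm, hac.symm, hbc.symm, if_false]
      field_simp
      ring
    · simp only [if_true, hab.symm, hac.symm, hbc.symm, if_false]
      rintro α β ⟨h4, h5, -⟩
      have hα : α = 0 := by linarith
      subst hα
      refine ⟨rfl, ?_⟩
      have : q / S b ≠ 0 := by positivity
      simpa [this, hq.ne', hB.ne'] using h5
  | succ k ih =>
    -- Two edges whose total is less than half the perimeter are merged into one; in the end both
    -- receive the same direction.
    by_cases hpair : ∃ a ∈ s, ∃ b ∈ s, a ≠ b ∧ 2 * (S a + S b) < ∑ j ∈ s, S j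
    · obtain ⟨a, ha, b, hb, hab, hlt⟩ := hpair
      have hae : a ∈ s.erase b := by simp [ha, hab]
      have hsplit : ∀ f : ι → ℝ, ∑ j ∈ s, f j = f a + f b + ∑ j ∈ (s.erase b).erase a, f j := by
        intro f
        rw [← Finset.add_sum_erase _ _ hb, ← Finset.add_sum_erase _ _ hae]
        ring
      set S' := Function.update S a (S a + S b) with hS'
      have hS'a : S' a = S a + S b := by simp [hS']
      have hS'ne : ∀ i ≠ a, S' i = S i := fun i hi => by simp [hS', hi]
      have hsplit' : ∀ f : ι → ℝ, ∑ j ∈ s.erase b, S' j * f j =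
          (S a + S b) * f a + ∑ j ∈ (s.erase b).erase a, S j * f j := by
        intro f
        rw [← Finset.add_sum_erase _ _ hae, hS'a]
        congr 1
        exact Finset.sum_congr rfl fun j hj => by rw [hS'ne j (Finset.ne_of_mem_erase hj)]
      have htot : ∑ j ∈ s.erase b, S' j = ∑ j ∈ s, S j := by
        have := hsplit' (fun _ => 1)
        simp only [mul_one] at this
        rw [this, hsplit]
      obtain ⟨x, y, h1, h2, h3, h4⟩ := ih (s.erase b) (by rw [Finset.card_erase_of_mem hb]; omega)
        S' (by
          intro i hi
          by_cases hia : i = a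
          · subst hia; rw [hS'a]; exact add_pos (hS _ ha) (hS _ hb)
          · rw [hS'ne i hia]; exact hS i (Finset.mem_of_mem_erase hi))
        (by
          intro i hi
          rw [htot]
          by_cases hia : i = a
          · subst hia; rw [hS'a]; exact hlt
          · rw [hS'ne i hia]; exact hpoly i (Finset.mem_of_mem_erase hi))
        (by rw [Finset.card_erase_of_mem hb]; omega)
      have hup : ∀ f : ι → ℝ, ∑ i ∈ s.erase b, S' i * f i = 0 →
          ∑ i ∈ s, S i * Function.update f b (f a) i = 0 := by
        intro f hf
        rw [hsplit' f] at hf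
        rw [hsplit, Function.update_self, Function.update_of_ne hab, ← hf, add_mul]
        congr 1
        refine Finset.sum_congr rfl fun j hj => ?_
        rw [Function.update_of_ne (Finset.ne_of_mem_erase (Finset.mem_of_mem_erase hj))]
      refine ⟨Function.update x b (x a), Function.update y b (y a), ?_, hup x h2, hup y h3, ?_⟩
      · intro i hi
        by_cases hib : i = b
        · subst hib; simpa using h1 a hae
        · simpa [hib] using h1 i (by simp [hi, hib])
      · intro α β h
        refine h4 α β fun i hi => ?_
        have := h i (Finset.mem_of_mem_erase hi)
        simpa [Finset.ne_of_mem_erase hi] using this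
    · push Not at hpair
      -- If no pair can be merged, every pair carries at least half the perimeter. With at least
      -- four edges this forces exactly four equal ones, which form a square.
      obtain ⟨a, ha⟩ : s.Nonempty := Finset.card_pos.mp (by omega)
      obtain ⟨b, hb⟩ : (s.erase a).Nonempty :=
        Finset.card_pos.mp (by rw [Finset.card_erase_of_mem ha]; omega)
      obtain ⟨c, hc⟩ : ((s.erase a).erase b).Nonempty := Finset.card_pos.mp (by
        rw [Finset.card_erase_of_mem hb, Finset.card_erase_of_mem ha]; omega)
      obtain ⟨d, hd⟩ : (((s.erase a).erase b).erase c).Nonempty := Finset.card_pos.mp (by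
        rw [Finset.card_erase_of_mem hc, Finset.card_erase_of_mem hb,
          Finset.card_erase_of_mem ha]; omega)
      have hsplit : ∀ f : ι → ℝ, ∑ j ∈ s, f j = f a + (f b + (f c + (f d +
          ∑ j ∈ (((s.erase a).erase b).erase c).erase d, f j))) := by
        intro f
        rw [← Finset.add_sum_erase _ _ ha, ← Finset.add_sum_erase _ _ hb,
          ← Finset.add_sum_erase _ _ hc, ← Finset.add_sum_erase _ _ hd]
      simp only [Finset.mem_erase, ne_eq] at hb hc hd
      obtain ⟨hba, hbs⟩ := hb
      obtain ⟨hcb, hca, hcs⟩ := hc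
      obtain ⟨hdc, hdb, hda, hds⟩ := hd
      have p1 := hpair a ha b hbs (Ne.symm hba)
      have p2 := hpair a ha c hcs (Ne.symm hca)
      have p3 := hpair a ha d hds (Ne.symm hda)
      have p4 := hpair b hbs c hcs (Ne.symm hcb)
      have p5 := hpair b hbs d hds (Ne.symm hdb)
      have p6 := hpair c hcs d hds (Ne.symm hdc)
      rw [hsplit S] at p1 p2 p3 p4 p5 p6
      set R := (((s.erase a).erase b).erase c).erase d with hR
      have hRs : ∀ i ∈ R, i ∈ s := fun i hi => by
        simp only [hR, Finset.mem_erase] at hi; exact hi.2.2.2.2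
      have hR0 : R = ∅ := by
        by_contra hne
        have : 0 < ∑ j ∈ R, S j := Finset.sum_pos (fun i hi => hS i (hRs i hi))
          (Finset.nonempty_iff_ne_empty.mpr hne)
        linarith
      simp only [hR0, Finset.sum_empty, add_zero] at p1 p2 p3 p4 p5 p6 hsplit
      have e1 : S b = S a := by linarith
      have e2 : S c = S a := by linarith
      have e3 : S d = S a := by linarith
      have hall : ∀ i ∈ s, i = a ∨ i = b ∨ i = c ∨ i = d := by
        intro i hi
        by_contra! hcon
        have : i ∈ R := by simp [hR, hi, hcon]
        rw [hR0] at this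
        simp at this
      refine ⟨fun i => if i = a then 1 else if i = b then -1 else 0,
        fun i => if i = c then 1 else if i = d then -1 else 0, ?_, ?_, ?_, ?_⟩
      · intro i hi
        rcases hall i hi with rfl | rfl | rfl | rfl
        · simp [Ne.symm hca, Ne.symm hda]
        · simp [hba, Ne.symm hcb, Ne.symm hdb]
        · simp [hca, hcb]
        · simp [hda, hdb, hdc]
      · simp [hsplit, hba, hca, hcb, hda, hdb, e1]
      · simp [hsplit, Ne.symm hca, Ne.symm hda, Ne.symm hcb, Ne.symm hdb, hdc, e2, e3]
      · intro α β h
        have q1 := h a ha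
        have q2 := h c hcs
        simp only [if_true, Ne.symm hca, Ne.symm hda, hca, hcb, if_false] at q1 q2
        constructor <;> linarith

/-! ### Lifting closed polygons to higher dimensions -/

/-- Latitudes for lifting a closed polygon to one more dimension. -/
lemma exists_latitudes {k : ℕ} (hk : 3 ≤ k) {S : Fin k → ℝ} (hS : ∀ i, 0 < S i) {T : ℝ}
    (hT : ∀ i, S i ≤ T) (hlt : T < ∑ i, S i) :
    ∃ c : Fin k → ℝ, Function.Injective c ∧ (∀ i, c i ^ 2 < 1) ∧ ∑ i, S i * c i = T ∧
      ∀ i, 2 * (S i * √(1 - c i ^ 2)) < ∑ j, S j * √(1 - c j ^ 2) := by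
  have : Nonempty (Fin k) := ⟨⟨0, by omega⟩⟩
  obtain ⟨p, hp⟩ := Finite.exists_max S
  have hothers : 0 < ∑ i ∈ Finset.univ.erase p, S i := by
    refine Finset.sum_pos (fun i _ => hS i) (Finset.card_pos.mp ?_)
    rw [Finset.card_erase_of_mem (Finset.mem_univ _), Finset.card_univ, Fintype.card_fin]; omega
  -- The horizontal lengths are capped to `min ρ (S i)`, and `g ρ` is the resulting total height. A
  -- positive cap below `ρ₁` keeps the strict polygon inequality, while at `ρ₁` the height has
  -- dropped below `T`.
  set ρ₁ := min (S p) (∑ i ∈ Finset.univ.erase p, S i) with hρ₁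
  have hρ₁pos : 0 < ρ₁ := lt_min (hS p) hothers
  set g : ℝ → ℝ := fun ρ => ∑ i, √(S i ^ 2 - min ρ (S i) ^ 2) with hg
  have hgc : Continuous g := by simp only [hg]; fun_prop
  have hg0 : T < g 0 := by
    have : g 0 = ∑ i, S i := Finset.sum_congr rfl fun i _ => by
      rw [min_eq_left (hS i).le]; simp [Real.sqrt_sq (hS i).le]
    rw [this]; exact hlt
  have hTpos : 0 < T := (hS p).trans_le (hT p)
  have hg1 : g ρ₁ < T := by
    by_cases hcase : S p ≤ ∑ i ∈ Finset.univ.erase p, S i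
    · have h1 : ρ₁ = S p := min_eq_left hcase
      have : g ρ₁ = 0 := Finset.sum_eq_zero fun i _ => by
        rw [h1, min_eq_right (hp i)]; simp
      rw [this]; exact hTpos
    · have h1 : ρ₁ = ∑ i ∈ Finset.univ.erase p, S i := min_eq_right (le_of_not_ge hcase)
      have h2 : ρ₁ < S p := by rw [h1]; exact lt_of_not_ge hcase
      have : g ρ₁ = √(S p ^ 2 - ρ₁ ^ 2) := by
        simp only [hg]
        rw [Finset.sum_eq_single p, min_eq_left h2.le]
        · intro i _ hi
          have : S i ≤ ρ₁ := by
            rw [h1]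
            exact Finset.single_le_sum (fun j _ => (hS j).le) (by simp [hi])
          rw [min_eq_right this]; simp
        · simp
      rw [this]
      refine lt_of_lt_of_le ?_ (hT p)
      rw [Real.sqrt_lt' (hS p)]
      nlinarith
  obtain ⟨ρ, ⟨hρ0, hρ1⟩, hρ⟩ := intermediate_value_Icc' hρ₁pos.le hgc.continuousOn
    ⟨hg1.le, hg0.le⟩
  have hρ0' : 0 < ρ := lt_of_le_of_ne hρ0 (by rintro rfl; exact hg0.ne' hρ)
  have hρ1' : ρ < ρ₁ := lt_of_le_of_ne hρ1 (by rintro rfl; exact hg1.ne hρ)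
  set r : Fin k → ℝ := fun i => min ρ (S i) with hr
  have hrpos : ∀ i, 0 < r i := fun i => lt_min hρ0' (hS i)
  have hrS : ∀ i, r i ≤ S i := fun i => min_le_right _ _
  set c₀ : Fin k → ℝ := fun i => √(S i ^ 2 - r i ^ 2) / S i with hc₀
  have hc₀sq : ∀ i, c₀ i ^ 2 = 1 - (r i / S i) ^ 2 := by
    intro i
    have := (hS i).ne'
    simp only [hc₀]
    rw [div_pow, Real.sq_sqrt (by nlinarith [hrpos i, hrS i])]
    field_simp
  have hc₀lt : ∀ i, c₀ i ^ 2 < 1 := by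
    intro i
    have := div_pos (hrpos i) (hS i)
    rw [hc₀sq]; nlinarith
  have hc₀sum : ∑ i, S i * c₀ i = T := by
    rw [← hρ]
    refine Finset.sum_congr rfl fun i _ => ?_
    simp only [hc₀]
    rw [mul_div_cancel₀ _ (hS i).ne']
  have hc₀r : ∀ i, S i * √(1 - c₀ i ^ 2) = r i := by
    intro i
    rw [hc₀sq, sub_sub_cancel, Real.sqrt_sq (div_pos (hrpos i) (hS i)).le,
      mul_div_cancel₀ _ (hS i).ne']
  have hpolyr : ∀ i, 2 * r i < ∑ j, r j := by
    intro i
    rw [← Finset.add_sum_erase _ _ (Finset.mem_univ i), two_mul]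
    refine add_lt_add_right ?_ _
    -- If another edge reaches the cap, it balances edge `i`, and a third edge gives strictness.
    -- Otherwise all other edges keep their full length; then `i = p` and their total is at least
    -- `ρ₁ > ρ`.
    by_cases hex : ∃ j ≠ i, ρ ≤ S j
    · obtain ⟨j, hj, hρj⟩ := hex
      have hji : j ∈ Finset.univ.erase i := by simp [hj]
      rw [← Finset.add_sum_erase _ _ hji]
      have h1 : r j = ρ := min_eq_left hρj
      have h2 : r i ≤ ρ := min_le_left _ _
      have h3 : 0 < ∑ l ∈ (Finset.univ.erase i).erase j, r l := by
        refine Finset.sum_pos (fun l _ => hrpos l) (Finset.card_pos.mp ?_)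
        rw [Finset.card_erase_of_mem hji, Finset.card_erase_of_mem (Finset.mem_univ _),
          Finset.card_univ, Fintype.card_fin]; omega
      linarith
    · push Not at hex
      by_cases hip : i = p
      · subst hip
        have h1 : ∑ j ∈ Finset.univ.erase i, r j = ∑ j ∈ Finset.univ.erase i, S j :=
          Finset.sum_congr rfl fun j hj => min_eq_right (hex j (Finset.ne_of_mem_erase hj)).le
        rw [h1]
        calc r i ≤ ρ := min_le_left _ _
          _ < ρ₁ := hρ1'
          _ ≤ _ := min_le_right _ _
      · have h1 := hex p (Ne.symm hip)
        have h2 : ρ₁ ≤ S p := min_le_left _ _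
        linarith
  have hSsum : 0 < ∑ i, S i := Finset.sum_pos (fun i _ => hS i) Finset.univ_nonempty
  -- A direction of perturbation with distinct entries and `∑ S i * d i = 0`: a small multiple makes
  -- the latitudes distinct without changing the total height.
  set d : Fin k → ℝ := fun i => (i : ℕ) - (∑ j, S j * (j : ℕ)) / ∑ j, S j with hd
  have hdsum : ∑ i, S i * d i = 0 := by
    simp only [hd, mul_sub, Finset.sum_sub_distrib]
    rw [← Finset.sum_mul, mul_div_cancel₀ _ hSsum.ne', sub_self]
  have hdne : ∀ i j, i ≠ j → d i ≠ d j := by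
    intro i j hij h
    simp only [hd, sub_left_inj, Nat.cast_inj] at h
    exact hij (Fin.ext h)
  have hev1 : ∀ᶠ ε : ℝ in 𝓝[>] 0, ∀ i, (c₀ i + ε * d i) ^ 2 < 1 := by
    rw [Filter.eventually_all]
    intro i
    have hc : ContinuousAt (fun ε : ℝ => (c₀ i + ε * d i) ^ 2) 0 := by fun_prop
    exact (hc.eventually_lt_const (by simpa using hc₀lt i)).filter_mono nhdsWithin_le_nhds
  have hev2 : ∀ᶠ ε : ℝ in 𝓝[>] 0, ∀ i, 2 * (S i * √(1 - (c₀ i + ε * d i) ^ 2)) <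
      ∑ j, S j * √(1 - (c₀ j + ε * d j) ^ 2) := by
    rw [Filter.eventually_all]
    intro i
    have hc : ContinuousAt (fun ε : ℝ => 2 * (S i * √(1 - (c₀ i + ε * d i) ^ 2))) 0 := by fun_prop
    have hc' : ContinuousAt (fun ε : ℝ => ∑ j, S j * √(1 - (c₀ j + ε * d j) ^ 2)) 0 := by fun_prop
    refine (hc.eventually_lt hc' ?_).filter_mono nhdsWithin_le_nhds
    simpa [hc₀r] using hpolyr i
  have hev3 : ∀ᶠ ε : ℝ in 𝓝[>] 0, ∀ i j, i ≠ j → c₀ i + ε * d i ≠ c₀ j + ε * d j := by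
    simp only [Filter.eventually_all]
    intro i j hij
    by_cases hcij : c₀ i = c₀ j
    · filter_upwards [self_mem_nhdsWithin] with ε hε h
      rw [hcij, add_right_inj] at h
      exact hdne i j hij (mul_left_cancel₀ (ne_of_gt hε) h)
    · have hc : ContinuousAt (fun ε : ℝ => c₀ i + ε * d i) 0 := by fun_prop
      have hc' : ContinuousAt (fun ε : ℝ => c₀ j + ε * d j) 0 := by fun_prop
      have := (hc.sub hc').eventually_ne (y := 0) (by simpa [sub_eq_zero] using hcij)
      exact (this.filter_mono nhdsWithin_le_nhds).mono fun ε h => sub_ne_zero.mp h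
  obtain ⟨ε, h1, h2, h3⟩ := (hev1.and (hev2.and hev3)).exists
  refine ⟨fun i => c₀ i + ε * d i, fun i j hij => ?_, h1, ?_, h2⟩
  · by_contra hne
    exact h3 i j hne hij
  · simp only [mul_add, Finset.sum_add_distrib, hc₀sum]
    have : ∑ i, S i * (ε * d i) = ε * ∑ i, S i * d i := by
      rw [Finset.mul_sum]; exact Finset.sum_congr rfl fun _ _ => by ring
    rw [this, hdsum]; ring

/-- Rows of `u` are the unit edge directions, spanning the space, of a closed polygon with edge
lengths `S`. -/
structure IsSpanningPolygon {d k : ℕ} (S : Fin k → ℝ) (u : Fin k → Fin d → ℝ) : Prop where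
  sum_sq_eq_one : ∀ i, ∑ j, u i j ^ 2 = 1
  sum_mul_eq_zero : ∀ j, ∑ i, S i * u i j = 0
  eq_zero_of_forall : ∀ x : Fin d → ℝ, (∀ i, ∑ j, u i j * x j = 0) → x = 0

lemma IsSpanningPolygon.comp_equiv {d k : ℕ} {S : Fin k → ℝ} {u : Fin k → Fin d → ℝ}
    (h : IsSpanningPolygon S u) (σ : Equiv.Perm (Fin k)) : IsSpanningPolygon (S ∘ σ) (u ∘ σ) where
  sum_sq_eq_one i := h.sum_sq_eq_one (σ i)
  sum_mul_eq_zero j := (Equiv.sum_comp σ fun i => S i * u i j).trans (h.sum_mul_eq_zero j)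
  eq_zero_of_forall x hx := h.eq_zero_of_forall x fun i => by
    obtain ⟨i, rfl⟩ := σ.surjective i
    exact hx i

/-- Lifting a spanning closed polygon to one more dimension by adding one downward edge. -/
lemma IsSpanningPolygon.lift {d k : ℕ} {S : Fin (k + 1) → ℝ} {c : Fin k → ℝ}
    (hc1 : ∀ i, c i ^ 2 < 1) (hcsum : ∑ i, S (Fin.castSucc i) * c i = S (Fin.last k))
    {w : Fin k → Fin d → ℝ}
    (h : IsSpanningPolygon (fun i => S (Fin.castSucc i) * √(1 - c i ^ 2)) w) :
    IsSpanningPolygon S (Fin.snoc (α := fun _ => Fin (d + 1) → ℝ)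
      (fun i => Fin.cons (c i) (fun j => √(1 - c i ^ 2) * w i j)) (Fin.cons (-1) fun _ => 0)) where
  sum_sq_eq_one i := by
    refine Fin.lastCases ?_ (fun i => ?_) i
    · simp [Fin.sum_univ_succ]
    · simp only [Fin.snoc_castSucc, Fin.sum_univ_succ, Fin.cons_zero, Fin.cons_succ, mul_pow]
      rw [← Finset.mul_sum, h.sum_sq_eq_one, Real.sq_sqrt (by linarith [hc1 i])]
      ring
  sum_mul_eq_zero j := by
    rw [Fin.sum_univ_castSucc]
    simp only [Fin.snoc_castSucc, Fin.snoc_last]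
    refine Fin.cases ?_ (fun j => ?_) j
    · simp only [Fin.cons_zero, hcsum]; ring
    · simp only [Fin.cons_succ, mul_zero, add_zero]
      rw [← h.sum_mul_eq_zero j]
      exact Finset.sum_congr rfl fun _ _ => by ring
  eq_zero_of_forall x hx := by
    have h0 : x 0 = 0 := by
      have := hx (Fin.last k)
      simpa [Fin.sum_univ_succ] using this
    have h1 : (fun j => x (Fin.succ j)) = 0 := by
      refine h.eq_zero_of_forall _ fun i => ?_
      have := hx (Fin.castSucc i)
      simp only [Fin.snoc_castSucc, Fin.sum_univ_succ, Fin.cons_zero, Fin.cons_succ, h0, mul_zero,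
        zero_add, mul_assoc] at this
      rw [← Finset.mul_sum] at this
      exact (mul_eq_zero.mp this).resolve_left (Real.sqrt_pos.mpr (by linarith [hc1 i])).ne'
    ext j
    refine Fin.cases h0 (fun j => ?_) j
    exact congrFun h1 j

lemma injective_snoc_cons {d k : ℕ} {c : Fin k → ℝ} (hc : Function.Injective c)
    (hc1 : ∀ i, c i ^ 2 < 1) (w : Fin k → Fin d → ℝ) (z : Fin d → ℝ) :
    Function.Injective (Fin.snoc (α := fun _ => Fin (d + 1) → ℝ)
      (fun i => Fin.cons (c i) (w i)) (Fin.cons (-1) z)) := by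
  have hne : ∀ i, c i ≠ -1 := fun i h => by have := hc1 i; rw [h] at this; norm_num at this
  intro i j
  refine Fin.lastCases ?_ (fun i => ?_) i <;> refine Fin.lastCases ?_ (fun j => ?_) j
  · simp
  · intro h
    have := congrFun h 0
    simp only [Fin.snoc_castSucc, Fin.snoc_last, Fin.cons_zero] at this
    exact absurd this.symm (hne j)
  · intro h
    have := congrFun h 0
    simp only [Fin.snoc_castSucc, Fin.snoc_last, Fin.cons_zero] at this
    exact absurd this (hne i)
  · intro h
    have := congrFun h 0
    simp only [Fin.snoc_castSucc, Fin.cons_zero] at this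
    rw [hc this]

/-- Induction on the dimension `d + 2`, with the longest edge pointing down and the horizontal parts
of the others closing up one dimension lower. Plane polygons may repeat directions; after a lift the
distinct latitudes separate them, whence injectivity for `1 ≤ d`. -/
lemma exists_isSpanningPolygon (d : ℕ) : ∀ {k : ℕ} (_ : d + 3 ≤ k) (S : Fin k → ℝ)
    (_ : ∀ i, 0 < S i) (_ : ∀ i, 2 * S i < ∑ j, S j),
    ∃ u : Fin k → Fin (d + 2) → ℝ, IsSpanningPolygon S u ∧ (1 ≤ d → Function.Injective u) := by
  induction d with
  | zero =>
    intro k hk S hS hpoly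
    obtain ⟨x, y, h1, h2, h3, h4⟩ := exists_plane_polygon Finset.univ
      (by rw [Finset.card_univ, Fintype.card_fin]; omega) S (fun i _ => hS i) (fun i _ => hpoly i)
    refine ⟨fun i => ![x i, y i], ⟨fun i => ?_, fun j => ?_, fun z hz => ?_⟩, by omega⟩
    · simpa using h1 i (Finset.mem_univ i)
    · fin_cases j
      · simpa using h2
      · simpa using h3
    · obtain ⟨e1, e2⟩ := h4 (z 0) (z 1) (fun i _ => by simpa using hz i)
      ext j
      fin_cases j
      · exact e1
      · exact e2
  | succ d ih =>
    have key : ∀ {k : ℕ} (_ : d + 4 ≤ k + 1) (S : Fin (k + 1) → ℝ) (_ : ∀ i, 0 < S i)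
        (_ : ∀ i, 2 * S i < ∑ j, S j) (_ : ∀ i, S i ≤ S (Fin.last k)),
        ∃ u : Fin (k + 1) → Fin (d + 3) → ℝ, IsSpanningPolygon S u ∧ Function.Injective u := by
      intro k hk S hS hpoly hmax
      have hlt : S (Fin.last k) < ∑ i, S (Fin.castSucc i) := by
        have := hpoly (Fin.last k)
        rw [Fin.sum_univ_castSucc] at this
        linarith
      obtain ⟨c, hcinj, hc1, hcsum, hcpoly⟩ := exists_latitudes (by omega)
        (fun i => hS (Fin.castSucc i)) (fun i => hmax (Fin.castSucc i)) hlt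
      obtain ⟨w, hw, -⟩ := ih (by omega) (fun i => S (Fin.castSucc i) * √(1 - c i ^ 2))
        (fun i => mul_pos (hS _) (Real.sqrt_pos.mpr (by linarith [hc1 i]))) hcpoly
      exact ⟨_, hw.lift hc1 hcsum, injective_snoc_cons hcinj hc1 _ _⟩
    intro k hk S hS hpoly
    obtain ⟨k, rfl⟩ : ∃ k', k = k' + 1 := ⟨k - 1, by omega⟩
    obtain ⟨p, hp⟩ := Finite.exists_max S
    set σ := Equiv.swap p (Fin.last k)
    obtain ⟨u, hu, hinj⟩ := key (by omega) (S ∘ σ) (fun i => hS _)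
      (fun i => by
        have : ∑ j, (S ∘ σ) j = ∑ j, S j := Equiv.sum_comp σ S
        rw [this]; exact hpoly _)
      (fun i => by simpa [σ] using hp _)
    refine ⟨u ∘ σ, ?_, fun _ => hinj.comp σ.injective⟩
    have := hu.comp_equiv σ
    rwa [show (S ∘ σ) ∘ σ = S by ext i; simp [σ]] at this

lemma exists_unit_vectors {n m : ℕ} (hn : 3 ≤ n) (hmn : n < m) {S : Fin m → ℝ}
    (hS : ∀ i, 0 < S i) (hpoly : ∀ i, 2 * S i < ∑ j, S j) :
    ∃ u : Fin m → 𝔼[n], (∀ i, ‖u i‖ = 1) ∧ Function.Injective u ∧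
      Submodule.span ℝ (Set.range u) = ⊤ ∧ ∑ i, S i • u i = 0 := by
  obtain ⟨d, rfl⟩ : ∃ d, n = d + 2 := ⟨n - 2, by omega⟩
  obtain ⟨u, hu, hinj⟩ := exists_isSpanningPolygon d (by omega) S hS hpoly
  refine ⟨fun i => WithLp.toLp 2 (u i), fun i => ?_, ?_, ?_, ?_⟩
  · rw [EuclideanSpace.norm_eq, Real.sqrt_eq_one]
    simpa using hu.sum_sq_eq_one i
  · exact (WithLp.toLp_injective 2).comp (hinj (by omega))
  · rw [← Submodule.orthogonal_eq_bot_iff, Submodule.eq_bot_iff]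
    intro x hx
    have h0 : x.ofLp = 0 := by
      refine hu.eq_zero_of_forall _ fun i => ?_
      have := (Submodule.mem_orthogonal _ _).mp hx _ (Submodule.subset_span ⟨i, rfl⟩)
      simpa [PiLp.inner_apply, mul_comm] using this
    ext j
    exact congrFun h0 j
  · ext j
    simpa using hu.sum_mul_eq_zero j

/-! ### The main theorem -/

theorem theorem1 (n m : ℕ) (hn : 3 ≤ n) (hmn : n < m) (S : Fin m → ℝ)
    (hS : Monotone S) (hpos : ∀ i, 0 < S i)
    (l : Fin m) (hl : (l : ℕ) + 1 = m) :
    List.TFAE [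
      ∃ (P : Set (EuclideanSpace ℝ (Fin n))) (F : Fin m → Set (EuclideanSpace ℝ (Fin n))),
        IsPolytope P ∧ ListsFacets P F ∧ ∀ i, area (F i) = ENNReal.ofReal (S i),
      ∃ (P : Set (EuclideanSpace ℝ (Fin n))) (F : Fin m → Set (EuclideanSpace ℝ (Fin n))),
        IsConvexPolytope P ∧ ListsFacets P F ∧ ∀ i, area (F i) = ENNReal.ofReal (S i),
      S l < ∑ i ∈ Finset.univ.erase l, S i] ∧
    (∀ (P : Set (EuclideanSpace ℝ (Fin n))) (F : Fin m → Set (EuclideanSpace ℝ (Fin n))),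
      IsLimitingPosition IsPolytope P F → (∀ i, area (F i) = ENNReal.ofReal (S i)) →
        S l ≤ ∑ i ∈ Finset.univ.erase l, S i ∧
        (S l = ∑ i ∈ Finset.univ.erase l, S i ↔ IsDoublyCountedFacet P F l)) ∧
    (∀ (P : Set (EuclideanSpace ℝ (Fin n))) (F : Fin m → Set (EuclideanSpace ℝ (Fin n))),
      IsLimitingPosition IsConvexPolytope P F → (∀ i, area (F i) = ENNReal.ofReal (S i)) →
        S l ≤ ∑ i ∈ Finset.univ.erase l, S i ∧
        (S l = ∑ i ∈ Finset.univ.erase l, S i ↔ IsDoublyCountedFacet P F l)) := by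
  refine ⟨?_, fun P F h hF => h.le_sum_and_eq_iff (by omega) (fun _ hQ => hQ) hpos hF,
    fun P F h hF => h.le_sum_and_eq_iff (by omega) (fun _ hQ => hQ.isPolytope) hpos hF⟩
  tfae_have 2 → 1 := fun ⟨P, F, hP, hF⟩ => ⟨P, F, hP.isPolytope, hF⟩
  tfae_have 1 → 3 := fun ⟨P, F, hP, hF, hA⟩ => hF.area_lt_sum (by omega) hP hpos hA l
  tfae_have 3 → 2 := by
    intro hlt
    -- Condition (iii) concerns the largest area only; by monotonicity it gives the polygon
    -- inequality for every index.
    have hpoly : ∀ i, 2 * S i < ∑ j, S j := by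
      intro i
      have h1 : S i ≤ S l := hS (Fin.le_def.mpr (by omega))
      rw [← Finset.add_sum_erase _ _ (Finset.mem_univ l)]
      linarith
    obtain ⟨u, hu, hinj, hspan, hsum⟩ := exists_unit_vectors hn hmn hpos hpoly
    exact exists_convexPolytope_of_normals (by omega) hu hinj hspan hpos hsum
  tfae_finish
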